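/- Let $M\ge 1$ and, for $m=1,\dots,M$, let $f_m(\cdot\,;0,1)$ be a probability density on $\mathbb{R}$ (with respect to Lebesgue measure); put $f_m(x;\mu,\sigma)=\frac1\sigma f_m\!\left(\frac{x-\mu}{\sigma};0,1\right)$ for $\mu\in\mathbb{R}$, $\sigma>0$. Let $$\Theta=\Big\{\theta=(\alpha_1,\mu_1,\sigma_1,\dots,\alpha_M,\mu_M,\sigma_M)\in\mathbb{R}^{3M} : \alpha_m\ge 0,\ \sum_{m=1}^M\alpha_m=1,\ \sigma_m>0\Big\}$$ with the Euclidean distance, and $f(x;\theta)=\sum_{m=1}^M\alpha_m f_m(x;\mu_m,\sigma_m)$. For $0\le K\le M$ let $\mathscr{G}_K$ be the set of all functions $\sum_{k\in\mathscr{K}}\alpha_k f_k(\cdot\,;\mu_k,\sigma_k)$ with $\mathscr{K}\subset\{1,\dots,M\}$, $|\mathscr{K}|\le K$ and $\theta\in\Theta$ (so $\mathscr{G}_0=\{0\}$). Let $\theta_0\in\Theta$ and $f_0=f(\cdot\,;\theta_0)$. Assume: 1. There are $v_0,v_1>0$ and $\beta>1$ with $f_m(x;0,1)\le\min\{v_0,\,v_1|x|^{-\beta}\}$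 for all $m$ and all $x$ (for $x=0$ the second bound is read as $+\infty$). 2. For each compact $\Gamma\subset\Theta$, each $\theta\in\Gamma$ and all sufficiently small $\rho>0$, the function $x\mapsto\sup\{f(x;\theta') : \theta'\in\Theta,\ \mathrm{dist}(\theta',\theta)\le\rho\}$ is (Lebesgue) measurable. 3. For each compact $\Gamma\subset\Theta$ and each $\theta\in\Gamma$ there is a Lebesgue null set $N$ such that for every sequence $\theta^{(j)}\in\Gamma$ with $\theta^{(j)}\to\theta$ and every $x\notin N$, $f(x;\theta^{(j)})\to f(x;\theta)$. 4. $\int|\log f(x;\theta_0)|\,f(x;\theta_0)\,dx<\infty$. 5. $f_0\in\mathscr{G}_M\setminus\mathscr{G}_{M-1}$. Let $c_0>0$, $0<d<1$, $c_n=c_0\exp(-n^d)$ and $\Theta_n=\{\theta\in\Theta : \sigma_m\ge c_n,\ m=1,\dots,M\}$. Let $x_1,x_2,\dots$ be independent real random variables on a probability space, each with density $f_0$, and let $\hat\theta_n$ be a maximum likelihood estimator restricted to $\Theta_n$: almost surely, for all sufficiently large $n$, $\hat\theta_n$ is a maximizer of $\theta\mapsto\prod_{i=1}^n f(x_i;\theta)$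 over $\Theta_n$. Then the estimated density $\hat f_n=f(\cdot\,;\hat\theta_n)$ is strongly consistent: $$\lim_{n\to\infty}\|\hat f_n-f_0\|_{L^1(\mathbb{R})}=0\quad\text{almost surely}.$$ -/

import Mathlib

open MeasureTheory ProbabilityTheory Filter Topology

noncomputable section

namespace LocScaleMixture

/-- Parameter vectors `(α₁, μ₁, σ₁, …, α_M, μ_M, σ_M) ∈ ℝ^{3M}`, with the Euclidean distance. -/
abbrev Param (M : ℕ) : Type := EuclideanSpace ℝ (Fin M × Fin 3)

/-- Mixing weight `α_m`. -/
def Param.weight {M : ℕ} (θ : Param M) (m : Fin M) : ℝ := θ (m, 0)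

/-- Location parameter `μ_m`. -/
def Param.loc {M : ℕ} (θ : Param M) (m : Fin M) : ℝ := θ (m, 1)

/-- Scale parameter `σ_m`. -/
def Param.scale {M : ℕ} (θ : Param M) (m : Fin M) : ℝ := θ (m, 2)

/-- The parameter space `Θ`. -/
def paramSpace (M : ℕ) : Set (Param M) :=
  {θ | (∑ m, θ.weight m = 1) ∧ (∀ m, 0 ≤ θ.weight m) ∧ ∀ m, 0 < θ.scale m}

/-- `φ` is a probability density on `ℝ` with respect to Lebesgue measure.
(`AEMeasurable` with respect to `volume` is Lebesgue measurability.) -/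
def IsDensity (φ : ℝ → ℝ) : Prop :=
  AEMeasurable φ volume ∧ (∀ x, 0 ≤ φ x) ∧ ∫⁻ x, ENNReal.ofReal (φ x) = 1

/-- The member with location `μ` and scale `σ` of the location-scale family generated by the
standard density `φ`. -/
def locScale (φ : ℝ → ℝ) (μ σ x : ℝ) : ℝ := (1 / σ) * φ ((x - μ) / σ)

/-- `f_𝒦(x; θ_𝒦) = ∑_{k ∈ 𝒦} α_k f_k(x; μ_k, σ_k)`; here `f m` is the standard density
`f_m(·; 0, 1)` of the `m`-th family. -/
def subMixture {M : ℕ} (f : Fin M → ℝ → ℝ) (K : Finset (Fin M)) (θ : Param M) (x : ℝ) : ℝ :=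
  ∑ k ∈ K, θ.weight k * locScale (f k) (θ.loc k) (θ.scale k) x

/-- The mixture density `f(x; θ)`. -/
def mixture {M : ℕ} (f : Fin M → ℝ → ℝ) (θ : Param M) (x : ℝ) : ℝ :=
  ∑ m, θ.weight m * locScale (f m) (θ.loc m) (θ.scale m) x

/-- `𝒢_𝒦`: the subprobability densities built from the components in `𝒦`. -/
def subDensities {M : ℕ} (f : Fin M → ℝ → ℝ) (K : Finset (Fin M)) : Set (ℝ → ℝ) :=
  {g | ∃ θ ∈ paramSpace M, ∑ k ∈ K, θ.weight k ≤ 1 ∧ g = subMixture f K θ}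

/-- `𝒢_k`: the subprobability densities with no more than `k` components. -/
def subDensitiesCard {M : ℕ} (f : Fin M → ℝ → ℝ) (k : ℕ) : Set (ℝ → ℝ) :=
  ⋃ (K : Finset (Fin M)) (_ : K.card ≤ k), subDensities f K

/-- The standard component densities are bounded, with tails of order at most `|x|^{-β}`,
for some `β > 1`. (At `x = 0` the tail bound is `+∞`, hence no condition.) -/
def TailBound {M : ℕ} (f : Fin M → ℝ → ℝ) : Prop :=
  ∃ v₀ v₁ β : ℝ, 0 < v₀ ∧ 0 < v₁ ∧ 1 < β ∧
    ∀ m x, f m x ≤ v₀ ∧ (x ≠ 0 → f m x ≤ v₁ * |x| ^ (-β))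

/-- `f(x; θ, ρ)`: the supremum of `f(x; θ')` over `θ' ∈ Θ` with `dist(θ', θ) ≤ ρ`. -/
def mixtureSup {M : ℕ} (f : Fin M → ℝ → ℝ) (θ : Param M) (ρ x : ℝ) : ℝ :=
  sSup ((fun θ' => mixture f θ' x) '' {θ' | θ' ∈ paramSpace M ∧ dist θ' θ ≤ ρ})

/-- For each `θ` in a compact subset of `Θ` and all sufficiently small `ρ > 0`, the function
`f(·; θ, ρ)` is (Lebesgue) measurable. -/
def LocalSupMeasurable {M : ℕ} (f : Fin M → ℝ → ℝ) : Prop :=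
  ∀ Γ : Set (Param M), IsCompact Γ → Γ ⊆ paramSpace M → ∀ θ ∈ Γ,
    ∀ᶠ ρ in 𝓝[>] (0 : ℝ), AEMeasurable (mixtureSup f θ ρ) volume

/-- On compact subsets of `Θ`, the density is sequentially continuous in the parameter off a
Lebesgue null set that does not depend on the sequence. -/
def ContinuousInParam {M : ℕ} (f : Fin M → ℝ → ℝ) : Prop :=
  ∀ Γ : Set (Param M), IsCompact Γ → Γ ⊆ paramSpace M → ∀ θ ∈ Γ,
    ∃ N : Set ℝ, volume N = 0 ∧
      ∀ θs : ℕ → Param M, (∀ j, θs j ∈ Γ) → Tendsto θs atTop (𝓝 θ) →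
        ∀ x, x ∉ N → Tendsto (fun j => mixture f (θs j) x) atTop (𝓝 (mixture f θ x))

/-- `∫ |log f(x; θ₀)| f(x; θ₀) dx < ∞`. -/
def FiniteEntropy {M : ℕ} (f : Fin M → ℝ → ℝ) (θ₀ : Param M) : Prop :=
  Integrable (fun x => |Real.log (mixture f θ₀ x)| * mixture f θ₀ x) volume

/-- The distribution on `ℝ` with density `f(·; θ)`. -/
def mixtureMeasure {M : ℕ} (f : Fin M → ℝ → ℝ) (θ : Param M) : Measure ℝ :=
  volume.withDensity fun x => ENNReal.ofReal (mixture f θ x)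

/-- The restricted parameter space of all `θ ∈ Θ` with `σ_m ≥ c` for every `m`. -/
def sieve (M : ℕ) (c : ℝ) : Set (Param M) :=
  {θ | θ ∈ paramSpace M ∧ ∀ m, c ≤ θ.scale m}

/-- The likelihood of the first `n` observations `x 0, …, x (n - 1)`. -/
def likelihood {M : ℕ} (f : Fin M → ℝ → ℝ) (x : ℕ → ℝ) (n : ℕ) (θ : Param M) : ℝ :=
  ∏ i ∈ Finset.range n, mixture f θ (x i)

/-- `θ` is a maximum likelihood estimate restricted to `S`, from the first `n` observations. -/
def IsMLE {M : ℕ} (f : Fin M → ℝ → ℝ) (S : Set (Param M)) (x : ℕ → ℝ) (n : ℕ)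
    (θ : Param M) : Prop :=
  θ ∈ S ∧ ∀ θ' ∈ S, likelihood f x n θ' ≤ likelihood f x n θ

end LocScaleMixture

end

namespace LocScaleMixture

open scoped ENNReal

/-! ### Hellinger affinity -/

/-! The argument is a Hellinger-type large deviation bound combined with a count of upper brackets.
For a fixed function `u`, Markov's inequality applied to `∏ √(u/f₀)(xᵢ)` bounds the probability that
`u` has likelihood at least that of `f₀` by `(∫ √(u f₀))ⁿ`. A density at `L¹` distance at least `ε`
from `f₀` has affinity at most `1 - ε²/8` with it (`affinity_le_of_le_eLpNorm`), and replacing it by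
an upper bracket of excess `η` adds at most `√η` (`IsUpperBracket.affinity_le`). A union bound over
`N` brackets then gives `N e^{-τn}` for the event that some far density in the sieve beats the truth
(`measure_exists_prod_le_prod_le`).

What remains is to keep `N` subexponential in `n`. Brackets need to dominate only on a window `[-A,
A]` containing the sample; the tail bound allows `A = exp(n^d)`. On this window a component with
very large scale or location lies below a small constant, so one bracket serves all of these. For
the others, `exists_local_majorant` gives a majorant near `(0, 1)` with integral close to `1`, and
translating and rescaling it over a grid of mesh proportional to the smallest scale `c` takes about
`(A/c)²` brackets. With `c = c₀ exp(-n^d)` this makes `N` of order `exp(4M n^d)`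
(`exists_bracket_number_le`), which `e^{-τn}` defeats because `d < 1`. Borel–Cantelli excludes far
maximizers, since `θ₀` itself eventually lies in the sieve. -/

lemma lintegral_sqrt_mul_sqrt_le {α : Type*} [MeasurableSpace α] {μ : Measure α}
    {u v : α → ℝ≥0∞} (hu : AEMeasurable u μ) (hv : AEMeasurable v μ) :
    ∫⁻ x, u x ^ (1 / 2 : ℝ) * v x ^ (1 / 2 : ℝ) ∂μ ≤
      (∫⁻ x, u x ∂μ) ^ (1 / 2 : ℝ) * (∫⁻ x, v x ∂μ) ^ (1 / 2 : ℝ) := by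
  have h := ENNReal.lintegral_mul_le_Lp_mul_Lq μ Real.HolderConjugate.two_two
    (hu.pow_const (1 / 2 : ℝ)) (hv.pow_const (1 / 2 : ℝ))
  have hsq : ∀ a : ℝ≥0∞, (a ^ (1 / 2 : ℝ)) ^ (2 : ℝ) = a := fun a => by
    rw [← ENNReal.rpow_mul]; norm_num
  simpa only [hsq, Pi.mul_apply] using h

/-- With `p = a²` and `q = b²`, weighted AM–GM gives `|a - b|(a + b) ≤ (a - b)²/(2t) + t(a + b)²/2`.
The affinity term stays on the left so that the inequality can be integrated in `ℝ≥0∞` without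
subtraction. -/
lemma abs_sub_add_sqrt_mul_sqrt_le {p q t : ℝ} (hp : 0 ≤ p) (hq : 0 ≤ q) (ht : 0 < t) :
    |p - q| + 1 / t * (√p * √q) ≤ (1 / (2 * t) + t) * (p + q) := by
  obtain ⟨a, ha, rfl⟩ : ∃ a, 0 ≤ a ∧ p = a ^ 2 := ⟨√p, Real.sqrt_nonneg _, (Real.sq_sqrt hp).symm⟩
  obtain ⟨b, hb, rfl⟩ : ∃ a, 0 ≤ a ∧ q = a ^ 2 := ⟨√q, Real.sqrt_nonneg _, (Real.sq_sqrt hq).symm⟩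
  rw [Real.sqrt_sq ha, Real.sqrt_sq hb]
  have key : ∀ s : ℝ, s ^ 2 = 1 → s * (a ^ 2 - b ^ 2) + 1 / t * (a * b) ≤
      (1 / (2 * t) + t) * (a ^ 2 + b ^ 2) := by
    intro s hs
    have h0 : 0 ≤ (1 / (2 * t)) * ((a - b) * s - t * (a + b)) ^ 2 := by positivity
    have h1 : (1 / (2 * t)) * ((a - b) * s - t * (a + b)) ^ 2 =
        (1 / (2 * t)) * (a - b) ^ 2 - s * (a ^ 2 - b ^ 2) + t / 2 * (a + b) ^ 2 := by
      field_simp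
      linear_combination (a - b) ^ 2 * hs
    have h2 : t / 2 * (a + b) ^ 2 ≤ t * (a ^ 2 + b ^ 2) := by
      nlinarith [mul_nonneg ht.le (sq_nonneg (a - b))]
    have h3 : (1 / (2 * t)) * (a - b) ^ 2 = 1 / (2 * t) * (a ^ 2 + b ^ 2) - 1 / t * (a * b) := by
      field_simp
      ring
    linarith
  rcases abs_cases (a ^ 2 - b ^ 2) with h | h
  · rw [h.1]; simpa using key 1 (by norm_num)
  · rw [h.1]; simpa using key (-1) (by norm_num)

lemma ofReal_rpow_half {p : ℝ} (hp : 0 ≤ p) :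
    ENNReal.ofReal p ^ (1 / 2 : ℝ) = ENNReal.ofReal √p := by
  rw [ENNReal.ofReal_rpow_of_nonneg hp (by norm_num), Real.sqrt_eq_rpow]

/-- Densities far apart in `L¹` have affinity bounded away from `1`. -/
lemma affinity_le_of_le_eLpNorm {p q : ℝ → ℝ} (hp : IsDensity p) (hq : IsDensity q) {ε : ℝ}
    (hε : 0 < ε) (h : ENNReal.ofReal ε ≤ eLpNorm (fun x => p x - q x) 1 volume) :
    ∫⁻ x, ENNReal.ofReal (p x) ^ (1 / 2 : ℝ) * ENNReal.ofReal (q x) ^ (1 / 2 : ℝ) ≤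
      ENNReal.ofReal (1 - ε ^ 2 / 8) := by
  obtain ⟨hpm, hp0, hp1⟩ := hp
  obtain ⟨hqm, hq0, hq1⟩ := hq
  set a : ℝ≥0∞ :=
    ∫⁻ x, ENNReal.ofReal (p x) ^ (1 / 2 : ℝ) * ENNReal.ofReal (q x) ^ (1 / 2 : ℝ) with ha
  have hsum : eLpNorm (fun x => p x - q x) 1 volume + ENNReal.ofReal (4 / ε) * a ≤
      ENNReal.ofReal (4 / ε + ε / 2) := by
    have hmeas : AEMeasurable (fun x => ENNReal.ofReal (p x) ^ (1 / 2 : ℝ) *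
        ENNReal.ofReal (q x) ^ (1 / 2 : ℝ)) volume := by fun_prop
    rw [eLpNorm_one_eq_lintegral_enorm, ha, ← lintegral_const_mul'' _ hmeas,
      ← lintegral_add_right' _ (hmeas.const_mul _)]
    calc _ ≤ ∫⁻ x, ENNReal.ofReal (2 / ε + ε / 4) *
          (ENNReal.ofReal (p x) + ENNReal.ofReal (q x)) := by
          refine lintegral_mono fun x => ?_
          -- Integration bounds the affinity by `1 - tε + 2t²`, which is least at `t = ε/4`.
          have hk := abs_sub_add_sqrt_mul_sqrt_le (hp0 x) (hq0 x) (t := ε / 4) (by positivity)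
          rw [ofReal_rpow_half (hp0 x), ofReal_rpow_half (hq0 x), Real.enorm_eq_ofReal_abs,
            ← ENNReal.ofReal_mul (by positivity), ← ENNReal.ofReal_mul (by positivity),
            ← ENNReal.ofReal_add (by positivity) (by positivity),
            ← ENNReal.ofReal_add (hp0 x) (hq0 x), ← ENNReal.ofReal_mul (by positivity)]
          refine ENNReal.ofReal_le_ofReal ?_
          convert hk using 2
          · field_simp
          · field_simp; ring
      _ = ENNReal.ofReal (4 / ε + ε / 2) := by
          rw [lintegral_const_mul'' _ (by fun_prop), lintegral_add_left' (by fun_prop), hp1, hq1,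
            ← ENNReal.ofReal_one, ← ENNReal.ofReal_add (by norm_num) (by norm_num),
            ← ENNReal.ofReal_mul (by positivity)]
          congr 1; ring
  have hfin : a ≠ ⊤ := by
    intro htop
    rw [htop, ENNReal.mul_top (by simpa using by positivity)] at hsum
    simp at hsum
  have h2 := (add_le_add_left h (ENNReal.ofReal (4 / ε) * a)).trans hsum
  rw [← ENNReal.ofReal_toReal hfin, ← ENNReal.ofReal_mul (by positivity),
    ← ENNReal.ofReal_add hε.le (by positivity), ENNReal.ofReal_le_ofReal_iff (by positivity)] at h2
  rw [← ENNReal.ofReal_toReal hfin]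
  refine ENNReal.ofReal_le_ofReal ?_
  have h3 : 4 / ε * a.toReal ≤ 4 / ε - ε / 2 := by linarith
  rw [← mul_le_mul_iff_right₀ (show 0 < 4 / ε by positivity)]
  refine h3.trans (le_of_eq ?_)
  field_simp
  ring

/-! ### Upper brackets -/

/-- `u` is a measurable majorant of `g` on `[-A, A]`, whose excess over `g` has integral at most
`η`. -/
structure IsUpperBracket (A : ℝ) (η : ℝ≥0∞) (g u : ℝ → ℝ≥0∞) : Prop where
  aemeasurable : AEMeasurable u volume
  le : ∀ x, |x| ≤ A → g x ≤ u x
  excess_le : ∫⁻ x, (u x - g x) ≤ η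

/-- The class `G` is covered by at most `N` upper brackets of excess `η` on `[-A, A]`. -/
def HasUpperBrackets (G : Set (ℝ → ℝ≥0∞)) (A : ℝ) (η : ℝ≥0∞) (N : ℕ) : Prop :=
  ∃ 𝒰 : Finset (ℝ → ℝ≥0∞), 𝒰.card ≤ N ∧ ∀ g ∈ G, ∃ u ∈ 𝒰, IsUpperBracket A η g u

/-- Subadditivity of the square root splits off `√(u - g)`, and Cauchy–Schwarz bounds its affinity
with `F`. Truncated subtraction gives `u ≤ g + (u - g)` everywhere, so domination on the window
plays no role here. -/
lemma IsUpperBracket.affinity_le {A : ℝ} {η : ℝ≥0∞} {g u F : ℝ → ℝ≥0∞}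
    (h : IsUpperBracket A η g u) (hg : AEMeasurable g volume) (hF : AEMeasurable F volume)
    (hF1 : ∫⁻ x, F x = 1) :
    ∫⁻ x, u x ^ (1 / 2 : ℝ) * F x ^ (1 / 2 : ℝ) ≤
      (∫⁻ x, g x ^ (1 / 2 : ℝ) * F x ^ (1 / 2 : ℝ)) + η ^ (1 / 2 : ℝ) := by
  calc ∫⁻ x, u x ^ (1 / 2 : ℝ) * F x ^ (1 / 2 : ℝ)
      ≤ ∫⁻ x, (g x ^ (1 / 2 : ℝ) * F x ^ (1 / 2 : ℝ) +
          (u x - g x) ^ (1 / 2 : ℝ) * F x ^ (1 / 2 : ℝ)) := by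
        refine lintegral_mono fun x => ?_
        rw [← add_mul]
        gcongr
        refine le_trans ?_ (ENNReal.rpow_add_le_add_rpow (g x) (u x - g x)
          (by norm_num) (by norm_num))
        gcongr
        exact le_add_tsub
    _ = (∫⁻ x, g x ^ (1 / 2 : ℝ) * F x ^ (1 / 2 : ℝ)) +
          ∫⁻ x, (u x - g x) ^ (1 / 2 : ℝ) * F x ^ (1 / 2 : ℝ) :=
        lintegral_add_left' (by fun_prop) _
    _ ≤ _ := by
        gcongr
        refine (lintegral_sqrt_mul_sqrt_le (h.aemeasurable.sub hg) hF).trans ?_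
        rw [hF1, ENNReal.one_rpow, mul_one]
        gcongr
        exact h.excess_le

/-! ### Large deviations of likelihood ratios -/

section Probability

variable {Ω : Type*} [MeasurableSpace Ω] {P : Measure Ω}
  {X : ℕ → Ω → ℝ} {F : ℝ → ℝ≥0∞}

/-- Markov's inequality for the product of the independent variables `√(u/F)(Xᵢ)`, each of which has
the affinity of `u` and `F` as its mean. No normalization of `u` is needed. -/
lemma measure_prod_le_prod_le (hX : ∀ i, Measurable (X i)) (hindep : iIndepFun X P)
    (hF : AEMeasurable F volume) (hFtop : ∀ x, F x ≠ ⊤)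
    (hlaw : ∀ i, P.map (X i) = volume.withDensity F) {u : ℝ → ℝ≥0∞}
    (hu : AEMeasurable u volume) (n : ℕ) :
    P {ω | ∏ i ∈ Finset.range n, F (X i ω) ≤ ∏ i ∈ Finset.range n, u (X i ω)} ≤
      (∫⁻ x, u x ^ (1 / 2 : ℝ) * F x ^ (1 / 2 : ℝ)) ^ n := by
  set g : ℝ → ℝ≥0∞ := fun x => u x ^ (1 / 2 : ℝ) / F x ^ (1 / 2 : ℝ) with hgdef
  have hg : AEMeasurable g volume := by fun_prop
  -- Independence passes to measurable functions of the `Xᵢ`, so `g` is replaced by a measurable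
  -- version; the law of `Xᵢ` does not see the difference.
  set gm := hg.mk g with hgm
  have hgmm : Measurable gm := hg.measurable_mk
  have hggm : ∀ i, ∀ᵐ ω ∂P, g (X i ω) = gm (X i ω) := by
    intro i
    have h1 : ∀ᵐ x ∂(P.map (X i)), g x = gm x := by
      rw [hlaw i]
      exact (withDensity_absolutelyContinuous _ _).ae_le hg.ae_eq_mk
    exact ae_of_ae_map (hX i).aemeasurable h1
  have hpos : ∀ i, ∀ᵐ ω ∂P, F (X i ω) ≠ 0 := by
    intro i
    have h1 : ∀ᵐ x ∂(P.map (X i)), F x ≠ 0 := by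
      rw [hlaw i, ae_withDensity_iff' hF]
      exact ae_of_all _ fun x hx => hx
    exact ae_of_ae_map (hX i).aemeasurable h1
  have hint : ∀ i, ∫⁻ ω, gm (X i ω) ∂P = ∫⁻ x, u x ^ (1 / 2 : ℝ) * F x ^ (1 / 2 : ℝ) := by
    intro i
    rw [← lintegral_map hgmm (hX i), hlaw i,
      lintegral_withDensity_eq_lintegral_mul₀ hF hgmm.aemeasurable]
    refine lintegral_congr_ae ?_
    filter_upwards [hg.ae_eq_mk] with x hx
    simp only [Pi.mul_apply]
    rw [hgm, ← hx, hgdef]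
    rcases eq_or_ne (F x) 0 with h0 | h0
    · simp [h0]
    · have hs0 : F x ^ (1 / 2 : ℝ) ≠ 0 := by simp [h0]
      have hst : F x ^ (1 / 2 : ℝ) ≠ ⊤ := by simp [hFtop x]
      have hsq : F x = F x ^ (1 / 2 : ℝ) * F x ^ (1 / 2 : ℝ) := by
        rw [← ENNReal.rpow_add _ _ h0 (hFtop x)]; norm_num
      calc F x * (u x ^ (1 / 2 : ℝ) / F x ^ (1 / 2 : ℝ))
          = F x ^ (1 / 2 : ℝ) * F x ^ (1 / 2 : ℝ) * (u x ^ (1 / 2 : ℝ) / F x ^ (1 / 2 : ℝ)) := by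
            rw [← hsq]
        _ = F x ^ (1 / 2 : ℝ) * u x ^ (1 / 2 : ℝ) := by
            rw [mul_assoc, ENNReal.mul_div_cancel hs0 hst]
        _ = _ := mul_comm _ _
  have hsub : P {ω | ∏ i ∈ Finset.range n, F (X i ω) ≤ ∏ i ∈ Finset.range n, u (X i ω)} ≤
      P {ω | 1 ≤ ∏ i ∈ Finset.range n, gm (X i ω)} := by
    refine measure_mono_ae ?_
    filter_upwards [ae_all_iff.2 hggm, ae_all_iff.2 hpos] with ω h1 h2 h3
    have h4 : ∏ i ∈ Finset.range n, F (X i ω) ≤ ∏ i ∈ Finset.range n, u (X i ω) := h3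
    change 1 ≤ ∏ i ∈ Finset.range n, gm (X i ω)
    have hP0 : ∏ i ∈ Finset.range n, F (X i ω) ^ (1 / 2 : ℝ) ≠ 0 :=
      Finset.prod_ne_zero_iff.2 fun i _ => by simp [h2 i]
    have hPt : ∏ i ∈ Finset.range n, F (X i ω) ^ (1 / 2 : ℝ) ≠ ⊤ :=
      ENNReal.prod_ne_top fun i _ => by simp [hFtop]
    rw [← ENNReal.mul_le_mul_iff_right hP0 hPt, mul_one, ← Finset.prod_mul_distrib]
    calc _ = (∏ i ∈ Finset.range n, F (X i ω)) ^ (1 / 2 : ℝ) :=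
          ENNReal.prod_rpow_of_nonneg (by norm_num)
      _ ≤ (∏ i ∈ Finset.range n, u (X i ω)) ^ (1 / 2 : ℝ) := by gcongr
      _ = ∏ i ∈ Finset.range n, u (X i ω) ^ (1 / 2 : ℝ) :=
          (ENNReal.prod_rpow_of_nonneg (by norm_num)).symm
      _ = _ := by
          refine Finset.prod_congr rfl fun i _ => ?_
          rw [← h1 i, hgdef]
          exact (ENNReal.mul_div_cancel (by simp [h2 i]) (by simp [hFtop])).symm
  refine hsub.trans ?_
  have hm := mul_meas_ge_le_lintegral (μ := P) (f := fun ω => ∏ i ∈ Finset.range n, gm (X i ω))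
    (by fun_prop) 1
  rw [one_mul] at hm
  refine hm.trans (le_of_eq ?_)
  have hind := hindep.comp (fun _ => gm) fun _ => hgmm
  have hprod := lintegral_prod_eq_prod_lintegral_of_indepFun (μ := P) (Finset.range n)
    (fun i => gm ∘ X i) hind fun i => hgmm.comp (hX i)
  simp only [Function.comp_apply] at hprod
  rw [hprod, Finset.prod_congr rfl fun i _ => hint i]
  simp

/-- Exponential bound for the event that some member of a bracketed class, all of whose members
are far from the true density, has a larger likelihood than the truth. -/
lemma measure_exists_prod_le_prod_le (hX : ∀ i, Measurable (X i)) (hindep : iIndepFun X P)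
    (hF : AEMeasurable F volume) (hFtop : ∀ x, F x ≠ ⊤) (hF1 : ∫⁻ x, F x = 1)
    (hlaw : ∀ i, P.map (X i) = volume.withDensity F) {G : Set (ℝ → ℝ≥0∞)} {A : ℝ} {η a : ℝ≥0∞}
    {N : ℕ} (hG : HasUpperBrackets G A η N) (hGm : ∀ g ∈ G, AEMeasurable g volume)
    (hGa : ∀ g ∈ G, ∫⁻ x, g x ^ (1 / 2 : ℝ) * F x ^ (1 / 2 : ℝ) ≤ a) (n : ℕ) :
    P {ω | (∀ i < n, |X i ω| ≤ A) ∧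
        ∃ g ∈ G, ∏ i ∈ Finset.range n, F (X i ω) ≤ ∏ i ∈ Finset.range n, g (X i ω)} ≤
      N * (a + η ^ (1 / 2 : ℝ)) ^ n := by
  classical
  obtain ⟨𝒰, hcard, h𝒰⟩ := hG
  -- Only brackets that serve some member of `G` inherit an affinity bound.
  set 𝒱 := 𝒰.filter fun u => ∃ g ∈ G, IsUpperBracket A η g u
  calc _ ≤ P (⋃ u ∈ 𝒱,
        {ω | ∏ i ∈ Finset.range n, F (X i ω) ≤ ∏ i ∈ Finset.range n, u (X i ω)}) := by
        refine measure_mono ?_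
        rintro ω ⟨hA, g, hg, hle⟩
        obtain ⟨u, hu, hb⟩ := h𝒰 g hg
        refine Set.mem_biUnion (Finset.mem_coe.2 (Finset.mem_filter.2 ⟨hu, g, hg, hb⟩)) ?_
        exact hle.trans (Finset.prod_le_prod' fun i hi => hb.le _ (hA i (Finset.mem_range.1 hi)))
    _ ≤ ∑ u ∈ 𝒱, P {ω | ∏ i ∈ Finset.range n, F (X i ω) ≤ ∏ i ∈ Finset.range n, u (X i ω)} :=
        measure_biUnion_finset_le _ _
    _ ≤ ∑ _u ∈ 𝒱, (a + η ^ (1 / 2 : ℝ)) ^ n := by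
        refine Finset.sum_le_sum fun u hu => ?_
        obtain ⟨-, g, hg, hb⟩ := Finset.mem_filter.1 hu
        refine (measure_prod_le_prod_le hX hindep hF hFtop hlaw hb.aemeasurable n).trans ?_
        gcongr
        exact (hb.affinity_le (hGm g hg) hF hF1).trans (by gcongr; exact hGa g hg)
    _ ≤ _ := by
        rw [Finset.sum_const, nsmul_eq_mul]
        gcongr
        exact (Finset.card_filter_le _ _).trans hcard

end Probability

/-! ### Tail bounds for the components -/

lemma TailBound.exists_le {M : ℕ} {f : Fin M → ℝ → ℝ} (h : TailBound f) :
    ∃ D β : ℝ, 0 < D ∧ 1 < β ∧ ∀ m x, f m x ≤ D * (1 + |x|) ^ (-β) := by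
  obtain ⟨v₀, v₁, β, hv₀, hv₁, hβ, hf⟩ := h
  -- The factor `2 ^ β` comes from `1 + |x| ≤ 2 max(1, |x|)`.
  refine ⟨(v₀ + v₁) * 2 ^ β, β, by positivity, hβ, fun m x => ?_⟩
  have hx := abs_nonneg x
  rcases le_total |x| 1 with h1 | h1
  · have h2 : 1 ≤ (2 : ℝ) ^ β * (1 + |x|) ^ (-β) := by
      rw [Real.rpow_neg (by positivity), ← div_eq_mul_inv, one_le_div (by positivity)]
      exact Real.rpow_le_rpow (by positivity) (by linarith) (by linarith)
    calc f m x ≤ v₀ := (hf m x).1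
      _ ≤ v₀ + v₁ := by linarith
      _ ≤ (v₀ + v₁) * (2 ^ β * (1 + |x|) ^ (-β)) := le_mul_of_one_le_right (by positivity) h2
      _ = _ := by ring
  · have h2 : |x| ^ (-β) ≤ (2 : ℝ) ^ β * (1 + |x|) ^ (-β) := by
      rw [Real.rpow_neg (by positivity), Real.rpow_neg (by positivity), ← div_eq_mul_inv,
        inv_le_comm₀ (by positivity) (by positivity), inv_div,
        ← Real.div_rpow (by positivity) (by positivity)]
      exact Real.rpow_le_rpow (by positivity) (by linarith) (by linarith)
    calc f m x ≤ v₁ * |x| ^ (-β) := (hf m x).2 (by intro h0; simp [h0] at h1; linarith)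
      _ ≤ v₁ * (2 ^ β * (1 + |x|) ^ (-β)) := by gcongr
      _ ≤ (v₀ + v₁) * (2 ^ β * (1 + |x|) ^ (-β)) := by gcongr; linarith
      _ = _ := by ring

/-- Weakening the exponent `-β` to `-1` makes the factor `1/σ` cancel, leaving a bound that is small
as soon as either `σ` or `|x - μ|` is large. -/
lemma locScale_le_div {φ : ℝ → ℝ} {D β : ℝ} (hD : 0 < D) (hβ : 1 < β)
    (hφ : ∀ x, φ x ≤ D * (1 + |x|) ^ (-β)) {μ σ : ℝ} (hσ : 0 < σ) (x : ℝ) :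
    locScale φ μ σ x ≤ D / (σ + |x - μ|) := by
  have h1 : (1 + |(x - μ) / σ|) ^ (-β) ≤ (1 + |(x - μ) / σ|)⁻¹ := by
    rw [← Real.rpow_neg_one]
    exact Real.rpow_le_rpow_of_exponent_le (by linarith [abs_nonneg ((x - μ) / σ)]) (by linarith)
  have h2 := (hφ ((x - μ) / σ)).trans (mul_le_mul_of_nonneg_left h1 hD.le)
  calc locScale φ μ σ x ≤ 1 / σ * (D * (1 + |(x - μ) / σ|)⁻¹) := by
        unfold locScale; gcongr
    _ = D / (σ + |x - μ|) := by
        rw [abs_div, abs_of_pos hσ]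
        field_simp

/-- For `x = μ + σy` one has `1 + |x| ≤ (1 + |μ| + σ)(1 + |y|)`. -/
lemma locScale_le_tail {φ : ℝ → ℝ} {D β : ℝ} (hD : 0 < D) (hβ : 1 < β)
    (hφ : ∀ x, φ x ≤ D * (1 + |x|) ^ (-β)) {μ σ : ℝ} (hσ : 0 < σ) (x : ℝ) :
    locScale φ μ σ x ≤ 1 / σ * D * (1 + |μ| + σ) ^ β * (1 + |x|) ^ (-β) := by
  set y := (x - μ) / σ with hy
  have hxy : x = μ + σ * y := by rw [hy]; field_simp; ring
  have hy0 := abs_nonneg y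
  have hx0 := abs_nonneg x
  have hμ0 := abs_nonneg μ
  have hb : 1 + |x| ≤ (1 + |μ| + σ) * (1 + |y|) := by
    have h1 : |x| ≤ |μ| + σ * |y| := by
      conv_lhs => rw [hxy]
      refine (abs_add_le _ _).trans ?_
      rw [abs_mul, abs_of_pos hσ]
    nlinarith [mul_nonneg hμ0 hy0]
  have h2 : (1 + |y|) ^ (-β) ≤ (1 + |μ| + σ) ^ β * (1 + |x|) ^ (-β) := by
    rw [Real.rpow_neg (by positivity), Real.rpow_neg (by positivity), ← div_eq_mul_inv,
      inv_le_comm₀ (by positivity) (by positivity), inv_div,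
      ← Real.div_rpow (by positivity) (by positivity)]
    refine Real.rpow_le_rpow (by positivity) ?_ (by linarith)
    rw [div_le_iff₀ (by positivity)]
    linarith
  calc locScale φ μ σ x ≤ 1 / σ * (D * (1 + |y|) ^ (-β)) := by
        unfold locScale; gcongr; exact hφ _
    _ ≤ 1 / σ * (D * ((1 + |μ| + σ) ^ β * (1 + |x|) ^ (-β))) := by gcongr
    _ = _ := by ring

lemma locScale_le_of_near {φ : ℝ → ℝ} {D β : ℝ} (hD : 0 < D) (hβ : 1 < β)
    (hφ : ∀ x, φ x ≤ D * (1 + |x|) ^ (-β)) {μ σ : ℝ} (hμ : |μ| ≤ 1 / 2) (hσ : |σ - 1| ≤ 1 / 2)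
    (x : ℝ) : locScale φ μ σ x ≤ 2 * D * 3 ^ β * (1 + |x|) ^ (-β) := by
  obtain ⟨hσ1, hσ2⟩ := abs_le.1 hσ
  have hσ0 : 0 < σ := by linarith
  refine (locScale_le_tail hD hβ hφ hσ0 x).trans ?_
  gcongr
  · rw [div_le_iff₀ hσ0]; linarith
  · linarith

lemma lintegral_tail_ne_top {D β : ℝ} (hβ : 1 < β) :
    ∫⁻ x : ℝ, ENNReal.ofReal (D * (1 + |x|) ^ (-β)) ≠ ⊤ := by
  have h := (integrable_one_add_norm (E := ℝ) (μ := volume) (r := β) (by simpa using hβ)).const_mul D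
  exact h.lintegral_lt_top.ne

/-! ### Affine changes of variables -/

lemma quasiMeasurePreserving_affine (μ : ℝ) {σ : ℝ} (hσ : 0 < σ) :
    Measure.QuasiMeasurePreserving (fun x : ℝ => (x - μ) / σ) volume volume := by
  have h1 := Measure.quasiMeasurePreserving_smul (volume : Measure ℝ) (r := σ⁻¹) (by positivity)
  have h2 := (measurePreserving_sub_right (volume : Measure ℝ) μ).quasiMeasurePreserving
  convert! h1.comp h2 using 1
  ext x
  simp [div_eq_inv_mul]

lemma lintegral_affine (g : ℝ → ℝ≥0∞) (μ : ℝ) {σ : ℝ} (hσ : 0 < σ) :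
    ∫⁻ x, ENNReal.ofReal (1 / σ) * g ((x - μ) / σ) = ∫⁻ x, g x := by
  rw [lintegral_const_mul' _ _ ENNReal.ofReal_ne_top,
    lintegral_sub_right_eq_self (fun x => g (x / σ)) μ]
  have h := lintegral_map_equiv (μ := volume) g
    (Homeomorph.mulLeft₀ σ⁻¹ (by positivity)).toMeasurableEquiv
  have hm := Real.map_volume_mul_left (a := σ⁻¹) (by positivity)
  have he : ((Homeomorph.mulLeft₀ σ⁻¹ (by positivity)).toMeasurableEquiv : ℝ → ℝ) =
    fun x => σ⁻¹ * x := rfl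
  rw [he, hm, lintegral_smul_measure, inv_inv, abs_of_pos hσ] at h
  have h' : ∫⁻ x, g (x / σ) = ENNReal.ofReal σ * ∫⁻ x, g x := by
    rw [← smul_eq_mul, h]
    simp only [div_eq_inv_mul]
  rw [h', ← mul_assoc, ← ENNReal.ofReal_mul (by positivity), one_div_mul_cancel hσ.ne',
    ENNReal.ofReal_one, one_mul]

lemma IsDensity.locScale {φ : ℝ → ℝ} (h : IsDensity φ) (μ : ℝ) {σ : ℝ} (hσ : 0 < σ) :
    IsDensity (locScale φ μ σ) := by
  refine ⟨(h.1.comp_quasiMeasurePreserving (quasiMeasurePreserving_affine μ hσ)).const_mul _,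
    fun x => mul_nonneg (by positivity) (h.2.1 _), ?_⟩
  rw [← h.2.2, ← lintegral_affine (fun x => ENNReal.ofReal (φ x)) μ hσ]
  refine lintegral_congr fun x => ?_
  rw [LocScaleMixture.locScale, ENNReal.ofReal_mul (by positivity)]

lemma IsDensity.mixture {M : ℕ} {f : Fin M → ℝ → ℝ} (hf : ∀ m, IsDensity (f m)) {θ : Param M}
    (hθ : θ ∈ paramSpace M) : IsDensity (mixture f θ) := by
  obtain ⟨h1, h0, hs⟩ := hθ
  have hl := fun m => (hf m).locScale (θ.loc m) (hs m)
  refine ⟨?_, fun x => Finset.sum_nonneg fun m _ => mul_nonneg (h0 m) ((hl m).2.1 x), ?_⟩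
  · exact Finset.aemeasurable_fun_sum _ fun m _ => (hl m).1.const_mul _
  · have he : ∀ x, ENNReal.ofReal (LocScaleMixture.mixture f θ x) = ∑ m,
        ENNReal.ofReal (θ.weight m) *
          ENNReal.ofReal (LocScaleMixture.locScale (f m) (θ.loc m) (θ.scale m) x) := fun x => by
      rw [LocScaleMixture.mixture,
        ENNReal.ofReal_sum_of_nonneg fun m _ => mul_nonneg (h0 m) ((hl m).2.1 x)]
      exact Finset.sum_congr rfl fun m _ => ENNReal.ofReal_mul (h0 m)
    simp_rw [he]
    rw [lintegral_finsetSum' _ fun m _ => (hl m).1.ennreal_ofReal.const_mul _]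
    simp_rw [lintegral_const_mul' _ _ ENNReal.ofReal_ne_top, (hl _).2.2, mul_one]
    rw [← ENNReal.ofReal_sum_of_nonneg fun m _ => h0 m, h1, ENNReal.ofReal_one]

/-! ### Parameters carried by a single component -/

/-- The parameter with all the weight on the component `m`, which has location `μ` and scale `σ`;
the idle components have location `0` and scale `1`. -/
noncomputable def vertex {M : ℕ} (m : Fin M) (μ σ : ℝ) : Param M :=
  WithLp.toLp 2 fun i => if i.1 = m then ![1, μ, σ] i.2 else ![0, 0, 1] i.2

section Vertex

variable {M : ℕ} (m : Fin M) (μ σ : ℝ)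

lemma weight_vertex (k : Fin M) : (vertex m μ σ).weight k = if k = m then 1 else 0 := by
  by_cases h : k = m <;> simp [Param.weight, vertex, h]

lemma loc_vertex (k : Fin M) : (vertex m μ σ).loc k = if k = m then μ else 0 := by
  by_cases h : k = m <;> simp [Param.loc, vertex, h]

lemma scale_vertex (k : Fin M) : (vertex m μ σ).scale k = if k = m then σ else 1 := by
  by_cases h : k = m <;> simp [Param.scale, vertex, h]

lemma vertex_mem_paramSpace {σ : ℝ} (hσ : 0 < σ) : vertex m μ σ ∈ paramSpace M := by
  refine ⟨by simp [weight_vertex], fun k => ?_, fun k => ?_⟩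
  · rw [weight_vertex]; split_ifs <;> norm_num
  · rw [scale_vertex]; split_ifs <;> [exact hσ; norm_num]

/-- Vertices carry the regularity assumed of mixtures over to the single components. -/
lemma mixture_vertex (f : Fin M → ℝ → ℝ) (x : ℝ) :
    mixture f (vertex m μ σ) x = locScale (f m) μ σ x := by
  simp [mixture, weight_vertex, loc_vertex, scale_vertex]

lemma dist_vertex_le : dist (vertex m μ σ) (vertex m 0 1) ≤ |μ| + |σ - 1| := by
  have h : vertex m μ σ - vertex m 0 1 =
      EuclideanSpace.single (m, (1 : Fin 3)) μ + EuclideanSpace.single (m, (2 : Fin 3)) (σ - 1) := by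
    ext ⟨k, j⟩
    by_cases h : k = m
    · fin_cases j <;> simp [vertex, h]
    · simp [vertex, h]
  rw [dist_eq_norm, h]
  refine (norm_add_le _ _).trans ?_
  simp

end Vertex

/-! ### Local suprema of the mixture density near a vertex -/

section LocalSup

variable {M : ℕ} {f : Fin M → ℝ → ℝ} {m : Fin M}

lemma abs_loc_le_of_dist_vertex {θ : Param M} {ρ : ℝ} (h : dist θ (vertex m 0 1) ≤ ρ)
    (k : Fin M) : |θ.loc k| ≤ ρ := by
  have h1 := (PiLp.norm_apply_le (θ - vertex m 0 1) (k, 1)).trans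
    ((dist_eq_norm θ _).symm.trans_le h)
  have h2 : vertex m 0 1 (k, 1) = 0 := (loc_vertex m 0 1 k).trans (by simp)
  simpa [Param.loc, h2] using h1

lemma abs_scale_sub_one_le_of_dist_vertex {θ : Param M} {ρ : ℝ} (h : dist θ (vertex m 0 1) ≤ ρ)
    (k : Fin M) : |θ.scale k - 1| ≤ ρ := by
  have h1 := (PiLp.norm_apply_le (θ - vertex m 0 1) (k, 2)).trans
    ((dist_eq_norm θ _).symm.trans_le h)
  have h2 : vertex m 0 1 (k, 2) = 1 := (scale_vertex m 0 1 k).trans (by simp)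
  simpa [Param.scale, h2] using h1

lemma mixture_le_of_dist_vertex {D β : ℝ} (hD : 0 < D) (hβ : 1 < β)
    (hf : ∀ m x, f m x ≤ D * (1 + |x|) ^ (-β)) {θ : Param M} (hθ : θ ∈ paramSpace M)
    (h : dist θ (vertex m 0 1) ≤ 1 / 2) (x : ℝ) :
    mixture f θ x ≤ 2 * D * 3 ^ β * (1 + |x|) ^ (-β) := by
  calc mixture f θ x ≤ ∑ k, θ.weight k * (2 * D * 3 ^ β * (1 + |x|) ^ (-β)) := by
        refine Finset.sum_le_sum fun k _ => mul_le_mul_of_nonneg_left ?_ (hθ.2.1 k)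
        exact locScale_le_of_near hD hβ (hf k) (abs_loc_le_of_dist_vertex h k)
          (abs_scale_sub_one_le_of_dist_vertex h k) x
    _ = _ := by rw [← Finset.sum_mul, hθ.1, one_mul]

lemma isCompact_near_vertex (m : Fin M) :
    IsCompact {θ : Param M | θ ∈ paramSpace M ∧ dist θ (vertex m 0 1) ≤ 1 / 2} := by
  -- Within radius `1/2` all scales are at least `1/2`, so the open condition of positive scales is
  -- automatic and the set is closed.
  have he : {θ : Param M | θ ∈ paramSpace M ∧ dist θ (vertex m 0 1) ≤ 1 / 2} =
      Metric.closedBall (vertex m 0 1) (1 / 2) ∩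
        ({θ | ∑ k, θ (k, 0) = 1} ∩ {θ | ∀ k, 0 ≤ θ (k, 0)}) := by
    ext θ
    constructor
    · rintro ⟨h, hd⟩
      exact ⟨hd, h.1, h.2.1⟩
    · rintro ⟨hd, h1, h0⟩
      refine ⟨⟨h1, h0, fun k => ?_⟩, hd⟩
      have := abs_le.1 (abs_scale_sub_one_le_of_dist_vertex hd k)
      linarith
  rw [he]
  refine (isCompact_closedBall _ _).inter_right (IsClosed.inter ?_ ?_)
  · exact isClosed_eq (by fun_prop) continuous_const
  · simp only [Set.ofPred_forall]
    exact isClosed_iInter fun k => isClosed_le continuous_const (by fun_prop)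

variable {D β : ℝ}

lemma bddAbove_mixture_near_vertex (hD : 0 < D) (hβ : 1 < β)
    (hf : ∀ m x, f m x ≤ D * (1 + |x|) ^ (-β)) {ρ : ℝ} (hρ : ρ ≤ 1 / 2) (x : ℝ) :
    BddAbove ((fun θ' => mixture f θ' x) ''
      {θ' | θ' ∈ paramSpace M ∧ dist θ' (vertex m 0 1) ≤ ρ}) := by
  refine ⟨2 * D * 3 ^ β * (1 + |x|) ^ (-β), ?_⟩
  rintro _ ⟨θ, ⟨hθ, hd⟩, rfl⟩
  exact mixture_le_of_dist_vertex hD hβ hf hθ (hd.trans hρ) x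

lemma nonempty_near_vertex {ρ : ℝ} (hρ : 0 ≤ ρ) (x : ℝ) :
    ((fun θ' => mixture f θ' x) ''
      {θ' | θ' ∈ paramSpace M ∧ dist θ' (vertex m 0 1) ≤ ρ}).Nonempty :=
  ⟨_, vertex m 0 1, ⟨vertex_mem_paramSpace m 0 one_pos, by simpa using hρ⟩, rfl⟩

lemma locScale_le_mixtureSup (hD : 0 < D) (hβ : 1 < β)
    (hf : ∀ m x, f m x ≤ D * (1 + |x|) ^ (-β)) {ρ : ℝ} (hρ : ρ ≤ 1 / 2) {μ σ : ℝ}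
    (h : |μ| + |σ - 1| ≤ ρ) (x : ℝ) :
    locScale (f m) μ σ x ≤ mixtureSup f (vertex m 0 1) ρ x := by
  refine le_csSup (bddAbove_mixture_near_vertex hD hβ hf hρ x) ?_
  refine ⟨vertex m μ σ, ⟨vertex_mem_paramSpace m μ ?_, (dist_vertex_le m μ σ).trans h⟩,
    mixture_vertex m μ σ f x⟩
  have := abs_le.1 (show |σ - 1| ≤ 1 / 2 by linarith [abs_nonneg μ])
  linarith

lemma mixtureSup_le (hD : 0 < D) (hβ : 1 < β)
    (hf : ∀ m x, f m x ≤ D * (1 + |x|) ^ (-β)) {ρ : ℝ} (hρ0 : 0 ≤ ρ) (hρ : ρ ≤ 1 / 2) (x : ℝ) :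
    mixtureSup f (vertex m 0 1) ρ x ≤ 2 * D * 3 ^ β * (1 + |x|) ^ (-β) := by
  refine csSup_le (nonempty_near_vertex hρ0 x) ?_
  rintro _ ⟨θ, ⟨hθ, hd⟩, rfl⟩
  exact mixture_le_of_dist_vertex hD hβ hf hθ (hd.trans hρ) x

/-- Near-maximizers converge to the vertex, so continuity in the parameter bounds the suprema from
above in the limit; the vertex itself bounds them from below. The near-maximizers depend on `x`,
which is why the null set must not depend on the sequence. -/
lemma tendsto_mixtureSup (h3 : ContinuousInParam f) (hD : 0 < D) (hβ : 1 < β)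
    (hf : ∀ m x, f m x ≤ D * (1 + |x|) ^ (-β)) {ρ : ℕ → ℝ} (hρ0 : ∀ j, 0 ≤ ρ j)
    (hρ : ∀ j, ρ j ≤ 1 / 2) (hlim : Tendsto ρ atTop (𝓝 0)) :
    ∀ᵐ x, Tendsto (fun j => mixtureSup f (vertex m 0 1) (ρ j) x) atTop (𝓝 (f m x)) := by
  obtain ⟨N, hN, hconv⟩ := h3 _ (isCompact_near_vertex m) (fun θ h => h.1) (vertex m 0 1)
    ⟨vertex_mem_paramSpace m 0 one_pos, by simp⟩
  filter_upwards [compl_mem_ae_iff.2 hN] with x hx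
  have hex : ∀ j : ℕ, ∃ θ : Param M, (θ ∈ paramSpace M ∧ dist θ (vertex m 0 1) ≤ ρ j) ∧
      mixtureSup f (vertex m 0 1) (ρ j) x - 1 / ((j : ℝ) + 1) < mixture f θ x := by
    intro j
    obtain ⟨_, ⟨θ, hθ, rfl⟩, hlt⟩ := exists_lt_of_lt_csSup
      (nonempty_near_vertex (f := f) (m := m) (hρ0 j) x)
      (show mixtureSup f (vertex m 0 1) (ρ j) x - 1 / ((j : ℝ) + 1) <
        mixtureSup f (vertex m 0 1) (ρ j) x by
          have : 0 < 1 / ((j : ℝ) + 1) := by positivity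
          linarith)
    exact ⟨θ, hθ, hlt⟩
  choose θs hθs hlt using hex
  have hθlim : Tendsto θs atTop (𝓝 (vertex m 0 1)) :=
    tendsto_iff_dist_tendsto_zero.2
      (squeeze_zero (fun _ => dist_nonneg) (fun j => (hθs j).2) hlim)
  have hmix := hconv θs (fun j => ⟨(hθs j).1, (hθs j).2.trans (hρ j)⟩) hθlim x hx
  have hv : mixture f (vertex m 0 1) x = f m x := by
    rw [mixture_vertex]; simp [locScale]
  rw [hv] at hmix
  have hup := hmix.add (tendsto_one_div_add_atTop_nhds_zero_nat (𝕜 := ℝ))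
  rw [add_zero] at hup
  refine tendsto_of_tendsto_of_tendsto_of_le_of_le tendsto_const_nhds hup (fun j => ?_)
    fun j => ?_
  · have := locScale_le_mixtureSup (m := m) hD hβ hf (hρ j) (μ := 0) (σ := 1)
      (by simpa using hρ0 j) x
    simpa [locScale] using this
  · have := hlt j
    simp only
    linarith

/-- A majorant of all members of the `m`-th family with parameters near `(0, 1)`, with integral
close to `1`. -/
lemma exists_local_majorant (hdens : IsDensity (f m)) (h2 : LocalSupMeasurable f)
    (h3 : ContinuousInParam f) (hD : 0 < D) (hβ : 1 < β)
    (hf : ∀ m x, f m x ≤ D * (1 + |x|) ^ (-β)) {η : ℝ≥0∞} (hη : 0 < η) :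
    ∃ ρ : ℝ, 0 < ρ ∧ ρ ≤ 1 / 2 ∧ ∃ S : ℝ → ℝ≥0∞, AEMeasurable S volume ∧ ∫⁻ x, S x ≤ 1 + η ∧
      ∀ μ σ : ℝ, |μ| + |σ - 1| ≤ ρ → ∀ x, ENNReal.ofReal (locScale (f m) μ σ x) ≤ S x := by
  have hmeas := h2 {vertex m 0 1} isCompact_singleton
    (by simpa using vertex_mem_paramSpace m 0 one_pos) _ rfl
  obtain ⟨r, hr, hrm⟩ := mem_nhdsGT_iff_exists_Ioo_subset.1 hmeas
  have hr0 : 0 < min r (1 / 2) := lt_min hr (by norm_num)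
  -- The shift by `2` keeps every radius strictly below `r`, inside the open interval where
  -- measurability holds.
  set ρ : ℕ → ℝ := fun j => min r (1 / 2) * (1 / ((j : ℝ) + 2)) with hρdef
  have hfrac : ∀ j : ℕ, 0 < 1 / ((j : ℝ) + 2) ∧ 1 / ((j : ℝ) + 2) < 1 := fun j => by
    refine ⟨by positivity, ?_⟩
    rw [div_lt_one (by positivity)]
    have : (0 : ℝ) ≤ j := j.cast_nonneg
    linarith
  have hρ0 : ∀ j, 0 < ρ j := fun j => mul_pos hr0 (hfrac j).1
  have hρlt : ∀ j, ρ j < min r (1 / 2) := fun j => mul_lt_of_lt_one_right hr0 (hfrac j).2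
  have hρ : ∀ j, ρ j ≤ 1 / 2 := fun j => (hρlt j).le.trans (min_le_right _ _)
  have hlim : Tendsto ρ atTop (𝓝 0) := by
    have h := ((tendsto_one_div_add_atTop_nhds_zero_nat (𝕜 := ℝ)).comp
      (tendsto_add_atTop_nat 1)).const_mul (min r (1 / 2))
    rw [mul_zero] at h
    refine h.congr fun j => ?_
    simp only [Function.comp_apply, hρdef]
    push_cast
    ring
  have hdom := tendsto_lintegral_of_dominated_convergence' (μ := volume)
    (F := fun j x => ENNReal.ofReal (mixtureSup f (vertex m 0 1) (ρ j) x))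
    (f := fun x => ENNReal.ofReal (f m x))
    (fun x => ENNReal.ofReal (2 * D * 3 ^ β * (1 + |x|) ^ (-β)))
    (fun j => AEMeasurable.ennreal_ofReal
      (hrm ⟨hρ0 j, (hρlt j).trans_le (min_le_left _ _)⟩))
    (fun j => ae_of_all _ fun x =>
      ENNReal.ofReal_le_ofReal (mixtureSup_le hD hβ hf (hρ0 j).le (hρ j) x))
    (lintegral_tail_ne_top hβ)
    ((tendsto_mixtureSup h3 hD hβ hf (fun j => (hρ0 j).le) hρ hlim).mono fun x hx =>
      (ENNReal.continuous_ofReal.tendsto _).comp hx)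
  rw [hdens.2.2] at hdom
  obtain ⟨j, hj⟩ := (hdom.eventually_le_const
    (show (1 : ℝ≥0∞) < 1 + η from ENNReal.lt_add_right (by simp) hη.ne')).exists
  exact ⟨ρ j, hρ0 j, hρ j, fun x => ENNReal.ofReal (mixtureSup f (vertex m 0 1) (ρ j) x),
    AEMeasurable.ennreal_ofReal (hrm ⟨hρ0 j, (hρlt j).trans_le (min_le_left _ _)⟩), hj,
    fun μ σ h x => ENNReal.ofReal_le_ofReal (locScale_le_mixtureSup hD hβ hf (hρ j) h x)⟩

end LocalSup

/-! ### Bracketing the sieve -/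

/-- The members of the location-scale family generated by `φ` with scale at least `c`. -/
def scaleSieve (φ : ℝ → ℝ) (c : ℝ) : Set (ℝ → ℝ≥0∞) :=
  {g | ∃ μ σ : ℝ, c ≤ σ ∧ g = fun x => ENNReal.ofReal (locScale φ μ σ x)}

/-- The mixture densities with all scales at least `c`. -/
def mixtureSieve {M : ℕ} (f : Fin M → ℝ → ℝ) (c : ℝ) : Set (ℝ → ℝ≥0∞) :=
  {g | ∃ θ ∈ sieve M c, g = fun x => ENNReal.ofReal (mixture f θ x)}

lemma locScale_eq_rescale (φ : ℝ → ℝ) (μ σ ν : ℝ) {τ : ℝ} (hτ : 0 < τ) (x : ℝ) :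
    locScale φ μ σ x = 1 / τ * locScale φ ((μ - ν) / τ) (σ / τ) ((x - ν) / τ) := by
  unfold locScale
  have h : ((x - ν) / τ - (μ - ν) / τ) / (σ / τ) = (x - μ) / σ := by
    rw [← sub_div, div_div_div_cancel_right₀ hτ.ne']
    ring
  rw [h]
  field_simp

/-- Beyond the threshold `2AD/η`, `locScale_le_div` puts the component below `η/(2A)` on the whole
window, and this constant has integral `η` there. Outside the window the bracket vanishes. -/
lemma isUpperBracket_far {φ : ℝ → ℝ} {D β : ℝ} (hD : 0 < D) (hβ : 1 < β)
    (hφ : ∀ x, φ x ≤ D * (1 + |x|) ^ (-β)) {A η μ σ : ℝ} (hA : 0 < A) (hη : 0 < η) (hσ : 0 < σ)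
    (hfar : 2 * A * D / η < σ ∨ 2 * A * D / η + A < |μ|) :
    IsUpperBracket A (ENNReal.ofReal η) (fun x => ENNReal.ofReal (locScale φ μ σ x))
      ((Set.Icc (-A) A).indicator fun _ => ENNReal.ofReal (η / (2 * A))) where
  aemeasurable := (measurable_const.indicator measurableSet_Icc).aemeasurable
  le x hx := by
    rw [Set.indicator_of_mem (Set.mem_Icc.2 (abs_le.1 hx))]
    refine ENNReal.ofReal_le_ofReal ((locScale_le_div hD hβ hφ hσ x).trans ?_)
    have hC : 0 < 2 * A * D / η := by positivity
    have h1 : 2 * A * D / η ≤ σ + |x - μ| := by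
      rcases hfar with h | h
      · linarith [abs_nonneg (x - μ)]
      · have : |μ| - |x| ≤ |x - μ| := by
          rw [abs_sub_comm]; exact abs_sub_abs_le_abs_sub μ x
        linarith
    calc D / (σ + |x - μ|) ≤ D / (2 * A * D / η) := by gcongr
      _ = η / (2 * A) := by field_simp
  excess_le := by
    refine (lintegral_mono fun x => tsub_le_self).trans ?_
    rw [lintegral_indicator measurableSet_Icc, setLIntegral_const, Real.volume_Icc,
      ← ENNReal.ofReal_mul (by positivity)]
    refine ENNReal.ofReal_le_ofReal (le_of_eq ?_)
    field_simp
    ring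

lemma isUpperBracket_near {φ : ℝ → ℝ} (hφ : IsDensity φ) {ρ : ℝ} {S : ℝ → ℝ≥0∞} {η : ℝ≥0∞}
    (hS : AEMeasurable S volume) (hS1 : ∫⁻ x, S x ≤ 1 + η)
    (hmaj : ∀ μ σ : ℝ, |μ| + |σ - 1| ≤ ρ → ∀ x, ENNReal.ofReal (locScale φ μ σ x) ≤ S x)
    {A μ σ ν τ : ℝ} (hσ : 0 < σ) (hτ : 0 < τ) (hclose : |(μ - ν) / τ| + |σ / τ - 1| ≤ ρ) :
    IsUpperBracket A η (fun x => ENNReal.ofReal (locScale φ μ σ x))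
      (fun x => ENNReal.ofReal (1 / τ) * S ((x - ν) / τ)) := by
  have hle : ∀ x, ENNReal.ofReal (locScale φ μ σ x) ≤
      ENNReal.ofReal (1 / τ) * S ((x - ν) / τ) := fun x => by
    rw [locScale_eq_rescale φ μ σ ν hτ x, ENNReal.ofReal_mul (by positivity)]
    gcongr
    exact hmaj _ _ hclose _
  refine ⟨(hS.comp_quasiMeasurePreserving (quasiMeasurePreserving_affine ν hτ)).const_mul _,
    fun x _ => hle x, ?_⟩
  have hd := hφ.locScale μ hσ
  rw [lintegral_sub' hd.1.ennreal_ofReal (by rw [hd.2.2]; simp) (ae_of_all _ hle), hd.2.2,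
    lintegral_affine S ν hτ]
  exact tsub_le_iff_left.2 hS1

/-- The scale is rounded up and the location down on a grid of mesh `s = ρc/2`. As the rounded scale
is at least `c`, each relative error is at most `ρ/2`, within reach of the rescaled majorant. -/
lemma hasUpperBrackets_scaleSieve {φ : ℝ → ℝ} (hφ : IsDensity φ) {D β : ℝ} (hD : 0 < D)
    (hβ : 1 < β) (hb : ∀ x, φ x ≤ D * (1 + |x|) ^ (-β)) {η ρ : ℝ} (hη : 0 < η) (hρ : 0 < ρ)
    {S : ℝ → ℝ≥0∞} (hS : AEMeasurable S volume) (hS1 : ∫⁻ x, S x ≤ 1 + ENNReal.ofReal η)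
    (hmaj : ∀ μ σ : ℝ, |μ| + |σ - 1| ≤ ρ → ∀ x, ENNReal.ofReal (locScale φ μ σ x) ≤ S x)
    {A c : ℝ} (hA : 0 < A) (hc : 0 < c) {T : ℕ}
    (hT : (2 * A * D / η + A) / (ρ / 2 * c) ≤ T) :
    HasUpperBrackets (scaleSieve φ c) A (ENNReal.ofReal η) (2 * (T + 1) ^ 2) := by
  classical
  set s : ℝ := ρ / 2 * c with hs
  have hs0 : 0 < s := by positivity
  -- The scale index `0` is never selected below, because `σ > 0`.
  set U : ℕ × ℤ → ℝ → ℝ≥0∞ := fun p x =>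
    ENNReal.ofReal (1 / (p.1 * s)) * S ((x - p.2 * s) / (p.1 * s)) with hU
  set V : ℝ → ℝ≥0∞ := (Set.Icc (-A) A).indicator fun _ => ENNReal.ofReal (η / (2 * A)) with hV
  refine ⟨insert V ((Finset.range (T + 1) ×ˢ Finset.Icc (-(T : ℤ)) T).image U), ?_, ?_⟩
  · refine (Finset.card_insert_le _ _).trans ?_
    have h1 := Finset.card_image_le (f := U)
      (s := Finset.range (T + 1) ×ˢ Finset.Icc (-(T : ℤ)) T)
    rw [Finset.card_product, Finset.card_range, Int.card_Icc] at h1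
    have h2 : ((T : ℤ) + 1 - -T).toNat = 2 * T + 1 := by omega
    rw [h2] at h1
    nlinarith
  · rintro _ ⟨μ, σ, hσc, rfl⟩
    have hσ : 0 < σ := hc.trans_le hσc
    by_cases hfar : 2 * A * D / η < σ ∨ 2 * A * D / η + A < |μ|
    · exact ⟨V, Finset.mem_insert_self _ _, isUpperBracket_far hD hβ hb hA hη hσ hfar⟩
    push Not at hfar
    obtain ⟨hσC, hμC⟩ := hfar
    have hσT : σ / s ≤ T := (div_le_div_of_nonneg_right (by linarith) hs0.le).trans hT
    have hμT : |μ / s| ≤ T := by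
      rw [abs_div, abs_of_pos hs0]
      exact (div_le_div_of_nonneg_right hμC hs0.le).trans hT
    obtain ⟨hμT1, hμT2⟩ := abs_le.1 hμT
    have hi1 : σ ≤ (⌈σ / s⌉₊ : ℝ) * s := (div_le_iff₀ hs0).1 (Nat.le_ceil _)
    have hi2 : (⌈σ / s⌉₊ : ℝ) * s ≤ σ + s := by
      have := Nat.ceil_lt_add_one (div_pos hσ hs0).le
      calc (⌈σ / s⌉₊ : ℝ) * s ≤ (σ / s + 1) * s := by gcongr
        _ = σ + s := by field_simp
    have hk1 : (⌊μ / s⌋ : ℝ) * s ≤ μ := (le_div_iff₀ hs0).1 (Int.floor_le _)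
    have hk2 : μ ≤ (⌊μ / s⌋ : ℝ) * s + s := by
      have := (div_le_iff₀ hs0).1 (Int.lt_floor_add_one (μ / s)).le
      linarith
    have hτ : 0 < (⌈σ / s⌉₊ : ℝ) * s := hσ.trans_le hi1
    refine ⟨U (⌈σ / s⌉₊, ⌊μ / s⌋), Finset.mem_insert_of_mem (Finset.mem_image_of_mem _ ?_),
      isUpperBracket_near hφ hS hS1 hmaj hσ hτ ?_⟩
    · simp only [Finset.mem_product, Finset.mem_range, Finset.mem_Icc]
      refine ⟨Nat.lt_succ_of_le (Nat.ceil_le.2 hσT), Int.le_floor.2 (by push_cast; linarith), ?_⟩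
      exact_mod_cast (Int.floor_le _).trans hμT2
    · have hsτ : s / ((⌈σ / s⌉₊ : ℝ) * s) ≤ ρ / 2 := by
        rw [div_le_iff₀ hτ, hs]
        gcongr
        exact hσc.trans hi1
      have h1 : |(μ - ⌊μ / s⌋ * s) / ((⌈σ / s⌉₊ : ℝ) * s)| ≤ ρ / 2 := by
        rw [abs_div, abs_of_pos hτ, abs_of_nonneg (by linarith)]
        exact (div_le_div_of_nonneg_right (by linarith) hτ.le).trans hsτ
      have h2 : |σ / ((⌈σ / s⌉₊ : ℝ) * s) - 1| ≤ ρ / 2 := by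
        rw [div_sub_one hτ.ne', abs_div, abs_of_pos hτ, abs_of_nonpos (by linarith)]
        exact (div_le_div_of_nonneg_right (by linarith) hτ.le).trans hsτ
      simp only
      linarith

lemma mul_sub_mul_le_excess {a α g u : ℝ≥0∞} (hα : α ≤ 1) :
    a * u - α * g ≤ (u - g) + (a - α) * u := by
  rw [tsub_le_iff_left]
  calc a * u ≤ (α + (a - α)) * u := by gcongr; exact le_add_tsub
    _ = α * u + (a - α) * u := add_mul _ _ _
    _ ≤ α * (g + (u - g)) + (a - α) * u := by gcongr; exact le_add_tsub
    _ = α * g + α * (u - g) + (a - α) * u := by rw [mul_add]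
    _ ≤ α * g + 1 * (u - g) + (a - α) * u := by gcongr
    _ = _ := by rw [one_mul, add_assoc]

/-- Rounding the weight up costs at most `η ∫ u ≤ 2η`, on top of the bracket's own excess `η`. -/
lemma IsUpperBracket.const_mul_excess_le {A : ℝ} {η a α : ℝ≥0∞} {g u : ℝ → ℝ≥0∞}
    (h : IsUpperBracket A η g u) (hg : AEMeasurable g volume) (hg1 : ∫⁻ x, g x = 1) (hα : α ≤ 1)
    (ha : a ≤ α + η) (hη : η ≤ 1) : ∫⁻ x, (a * u x - α * g x) ≤ 3 * η := by
  have hu : ∫⁻ x, u x ≤ 2 := by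
    calc ∫⁻ x, u x ≤ ∫⁻ x, (g x + (u x - g x)) := lintegral_mono fun x => le_add_tsub
      _ = 1 + ∫⁻ x, (u x - g x) := by rw [lintegral_add_left' hg, hg1]
      _ ≤ 1 + 1 := by gcongr; exact h.excess_le.trans hη
      _ = 2 := one_add_one_eq_two
  calc ∫⁻ x, (a * u x - α * g x) ≤ ∫⁻ x, ((u x - g x) + η * u x) := by
        refine lintegral_mono fun x => (mul_sub_mul_le_excess hα).trans ?_
        gcongr
        exact tsub_le_iff_left.2 ha
    _ = (∫⁻ x, (u x - g x)) + η * ∫⁻ x, u x := by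
        rw [lintegral_add_right' _ (h.aemeasurable.const_mul _),
          lintegral_const_mul'' _ h.aemeasurable]
    _ ≤ η + η * 2 := by gcongr; exact h.excess_le
    _ = 3 * η := by ring

lemma hasUpperBrackets_mixtureSieve {M : ℕ} {f : Fin M → ℝ → ℝ} (hf : ∀ m, IsDensity (f m))
    {A η c : ℝ} (hη : 0 < η) (hη1 : η ≤ 1) {N : ℕ}
    (hN : ∀ m, HasUpperBrackets (scaleSieve (f m) c) A (ENNReal.ofReal η) N) :
    HasUpperBrackets (mixtureSieve f c) A (ENNReal.ofReal (M * (3 * η)))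
      (((⌈1 / η⌉₊ + 1) * N) ^ M) := by
  classical
  choose 𝒰 hcard h𝒰 using hN
  -- Weights are rounded up to multiples of `η`, and each component is replaced by one of its
  -- brackets.
  set W : (Fin M → ℕ × (ℝ → ℝ≥0∞)) → ℝ → ℝ≥0∞ := fun p x =>
    ∑ m, ENNReal.ofReal ((p m).1 * η) * (p m).2 x with hW
  refine ⟨(Fintype.piFinset fun m => Finset.range (⌈1 / η⌉₊ + 1) ×ˢ 𝒰 m).image W, ?_, ?_⟩
  · refine Finset.card_image_le.trans ?_
    rw [Fintype.card_piFinset]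
    refine (Finset.prod_le_pow_card _ _ ((⌈1 / η⌉₊ + 1) * N) fun m _ => ?_).trans (by simp)
    rw [Finset.card_product, Finset.card_range]
    exact Nat.mul_le_mul_left _ (hcard m)
  · rintro _ ⟨θ, ⟨⟨h1, h0, hs⟩, hcs⟩, rfl⟩
    have hl := fun m => (hf m).locScale (θ.loc m) (hs m)
    have hw1 : ∀ m, θ.weight m ≤ 1 := fun m => by
      rw [← h1]
      exact Finset.single_le_sum (fun k _ => h0 k) (Finset.mem_univ m)
    have hex := fun m => h𝒰 m _ ⟨θ.loc m, θ.scale m, hcs m, rfl⟩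
    choose u hu hub using hex
    set l : Fin M → ℕ := fun m => ⌈θ.weight m / η⌉₊ with hldef
    have hl1 : ∀ m, θ.weight m ≤ l m * η := fun m => (div_le_iff₀ hη).1 (Nat.le_ceil _)
    have hl2 : ∀ m, l m * η ≤ θ.weight m + η := fun m => by
      have := (Nat.ceil_lt_add_one (div_nonneg (h0 m) hη.le)).le
      calc (l m : ℝ) * η ≤ (θ.weight m / η + 1) * η := by gcongr
        _ = θ.weight m + η := by field_simp
    have hmix : ∀ x, ENNReal.ofReal (mixture f θ x) = ∑ m, ENNReal.ofReal (θ.weight m) *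
        ENNReal.ofReal (locScale (f m) (θ.loc m) (θ.scale m) x) := fun x => by
      rw [mixture, ENNReal.ofReal_sum_of_nonneg fun m _ => mul_nonneg (h0 m) ((hl m).2.1 x)]
      exact Finset.sum_congr rfl fun m _ => ENNReal.ofReal_mul (h0 m)
    refine ⟨W fun m => (l m, u m), Finset.mem_image_of_mem _ ?_, ?_, ?_, ?_⟩
    · refine Fintype.mem_piFinset.2 fun m => Finset.mem_product.2 ⟨?_, hu m⟩
      refine Finset.mem_range.2 (Nat.lt_succ_of_le (Nat.ceil_mono ?_))
      exact div_le_div_of_nonneg_right (hw1 m) hη.le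
    · exact Finset.aemeasurable_fun_sum _ fun m _ => (hub m).aemeasurable.const_mul _
    · intro x hx
      rw [hmix]
      refine Finset.sum_le_sum fun m _ => ?_
      gcongr
      · exact hl1 m
      · exact (hub m).le x hx
    · calc _ ≤ ∫⁻ x, ∑ m, (ENNReal.ofReal (l m * η) * u m x - ENNReal.ofReal (θ.weight m) *
            ENNReal.ofReal (locScale (f m) (θ.loc m) (θ.scale m) x)) := by
            refine lintegral_mono fun x => ?_
            simp only [hmix, hW]
            rw [tsub_le_iff_left, ← Finset.sum_add_distrib]
            exact Finset.sum_le_sum fun m _ => le_add_tsub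
        _ = ∑ m, ∫⁻ x, (ENNReal.ofReal (l m * η) * u m x - ENNReal.ofReal (θ.weight m) *
            ENNReal.ofReal (locScale (f m) (θ.loc m) (θ.scale m) x)) :=
            lintegral_finsetSum' _ fun m _ => ((hub m).aemeasurable.const_mul _).sub
              ((hl m).1.ennreal_ofReal.const_mul _)
        _ ≤ ∑ _m : Fin M, 3 * ENNReal.ofReal η := by
            refine Finset.sum_le_sum fun m _ => (hub m).const_mul_excess_le
              (hl m).1.ennreal_ofReal (hl m).2.2 (ENNReal.ofReal_le_one.2 (hw1 m)) ?_
              (ENNReal.ofReal_le_one.2 hη1)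
            rw [← ENNReal.ofReal_add (h0 m) hη.le]
            exact ENNReal.ofReal_le_ofReal (hl2 m)
        _ = _ := by
            rw [Finset.sum_const, Finset.card_univ, Fintype.card_fin, nsmul_eq_mul,
              ENNReal.ofReal_mul (by positivity), ENNReal.ofReal_mul (by norm_num),
              ENNReal.ofReal_natCast, ENNReal.ofReal_ofNat]

/-- On the sieve with scales at least `c₀ e⁻ᵗ`, the number of brackets valid on `[-eᵗ, eᵗ]` grows
at most exponentially in `t`. -/
lemma exists_bracket_number_le {M : ℕ} {f : Fin M → ℝ → ℝ} (hf : ∀ m, IsDensity (f m))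
    (h1 : TailBound f) (h2 : LocalSupMeasurable f) (h3 : ContinuousInParam f) {c₀ η : ℝ}
    (hc₀ : 0 < c₀) (hη : 0 < η) (hη1 : η ≤ 1) :
    ∃ B : ℝ, 0 ≤ B ∧ ∀ t : ℝ, 0 ≤ t → ∃ N : ℕ,
      HasUpperBrackets (mixtureSieve f (c₀ * Real.exp (-t))) (Real.exp t)
        (ENNReal.ofReal (M * (3 * η))) N ∧ (N : ℝ) ≤ B * Real.exp (4 * M * t) := by
  obtain ⟨D, β, hD, hβ, hb⟩ := h1.exists_le
  have hloc := fun m => exists_local_majorant (hf m) h2 h3 hD hβ hb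
    (ENNReal.ofReal_pos.2 hη)
  choose ρ hρ _ S hS hS1 hmaj using hloc
  -- The sum serves as a common bound for all `1 / ρ m`, also when `M = 0`.
  set κ : ℝ := ∑ m, 1 / ρ m with hκ
  have hκ0 : 0 ≤ κ := Finset.sum_nonneg fun m _ => by have := hρ m; positivity
  have hκm : ∀ m, 1 / ρ m ≤ κ := fun m => Finset.single_le_sum (f := fun m => 1 / ρ m)
    (fun k _ => by have := hρ k; positivity) (Finset.mem_univ m)
  set K : ℝ := (2 * D / η + 1) * (2 / c₀) * κ with hK
  have hK0 : 0 ≤ K := by positivity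
  set L : ℝ := (⌈1 / η⌉₊ : ℝ) + 1 with hL
  refine ⟨(L * (2 * (K + 2) ^ 2)) ^ M, by positivity, fun t ht => ?_⟩
  set T : ℕ := ⌈K * Real.exp (2 * t)⌉₊ with hT
  refine ⟨((⌈1 / η⌉₊ + 1) * (2 * (T + 1) ^ 2)) ^ M,
    hasUpperBrackets_mixtureSieve hf hη hη1 fun m =>
      hasUpperBrackets_scaleSieve (hf m) hD hβ (hb m) hη (hρ m) (hS m) (hS1 m) (hmaj m)
        (Real.exp_pos t) (by positivity) ?_, ?_⟩
  · refine le_trans ?_ (Nat.le_ceil _)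
    have hρm := hρ m
    have he : Real.exp (2 * t) = Real.exp t * Real.exp t := by rw [← Real.exp_add]; ring_nf
    calc (2 * Real.exp t * D / η + Real.exp t) / (ρ m / 2 * (c₀ * Real.exp (-t)))
        = (2 * D / η + 1) * (2 / c₀) * (1 / ρ m) * Real.exp (2 * t) := by
          rw [he, Real.exp_neg]
          field_simp
      _ ≤ K * Real.exp (2 * t) := by
          rw [hK]
          gcongr
          exact hκm m
  · have he : 1 ≤ Real.exp (2 * t) := Real.one_le_exp (by positivity)
    have hT1 : (T : ℝ) + 1 ≤ (K + 2) * Real.exp (2 * t) := by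
      have := Nat.ceil_lt_add_one (show 0 ≤ K * Real.exp (2 * t) by positivity)
      rw [← hT] at this
      nlinarith
    have hexp : Real.exp (4 * M * t) = (Real.exp (2 * t) ^ 2) ^ M := by
      rw [← Real.exp_nat_mul, ← Real.exp_nat_mul]
      congr 1
      push_cast
      ring
    push_cast
    rw [hexp, ← mul_pow]
    refine pow_le_pow_left₀ (by positivity) ?_ M
    calc L * (2 * ((T : ℝ) + 1) ^ 2) ≤ L * (2 * ((K + 2) * Real.exp (2 * t)) ^ 2) := by gcongr
      _ = _ := by ring

/-! ### Tails of the sample -/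

lemma exists_mixture_le_tail {M : ℕ} {f : Fin M → ℝ → ℝ} (h1 : TailBound f) {θ : Param M}
    (hθ : θ ∈ paramSpace M) :
    ∃ C β : ℝ, 0 ≤ C ∧ 1 < β ∧ ∀ x, mixture f θ x ≤ C * (1 + |x|) ^ (-β) := by
  obtain ⟨D, β, hD, hβ, hb⟩ := h1.exists_le
  refine ⟨∑ m, θ.weight m * (1 / θ.scale m * D * (1 + |θ.loc m| + θ.scale m) ^ β), β,
    Finset.sum_nonneg fun m _ => ?_, hβ, fun x => ?_⟩
  · have := hθ.2.1 m
    have := hθ.2.2 m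
    positivity
  · rw [Finset.sum_mul]
    refine Finset.sum_le_sum fun m _ => ?_
    rw [mul_assoc]
    exact mul_le_mul_of_nonneg_left (locScale_le_tail hD hβ (hb m) (hθ.2.2 m) x) (hθ.2.1 m)

lemma exists_mixtureMeasure_tail_le {M : ℕ} {f : Fin M → ℝ → ℝ} (h1 : TailBound f) {θ : Param M}
    (hθ : θ ∈ paramSpace M) :
    ∃ I p : ℝ, 0 ≤ I ∧ 0 < p ∧ ∀ A : ℝ, 0 < A →
      mixtureMeasure f θ {x | A < |x|} ≤ ENNReal.ofReal (I * A ^ (-p)) := by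
  obtain ⟨C, β, hC, hβ, hmix⟩ := exists_mixture_le_tail h1 hθ
  -- Half of the surplus `β - 1` pays for the decay in `A`; the remaining exponent `β - p` still
  -- exceeds `1`, so the integral stays finite.
  set p : ℝ := (β - 1) / 2 with hp
  have hp0 : 0 < p := by rw [hp]; linarith
  have hI := lintegral_tail_ne_top (D := C) (β := β - p) (by rw [hp]; linarith)
  refine ⟨(∫⁻ x : ℝ, ENNReal.ofReal (C * (1 + |x|) ^ (-(β - p)))).toReal, p,
    ENNReal.toReal_nonneg, hp0, fun A hA => ?_⟩
  have hset : MeasurableSet {x : ℝ | A < |x|} :=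
    measurableSet_lt measurable_const continuous_abs.measurable
  rw [mixtureMeasure, withDensity_apply _ hset, ENNReal.ofReal_mul ENNReal.toReal_nonneg,
    ENNReal.ofReal_toReal hI, mul_comm, ← lintegral_const_mul' _ _ ENNReal.ofReal_ne_top]
  refine le_trans ?_ (setLIntegral_le_lintegral {x : ℝ | A < |x|} _)
  refine setLIntegral_mono' hset fun x hx => ?_
  have hxA : A < |x| := hx
  rw [← ENNReal.ofReal_mul (by positivity)]
  refine ENNReal.ofReal_le_ofReal ((hmix x).trans ?_)
  have h0 : 0 < 1 + |x| := by positivity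
  have hsplit : (1 + |x|) ^ (-β) = (1 + |x|) ^ (-p) * (1 + |x|) ^ (-(β - p)) := by
    rw [← Real.rpow_add h0]; ring_nf
  have hle : (1 + |x|) ^ (-p) ≤ A ^ (-p) :=
    Real.rpow_le_rpow_of_nonpos hA (by linarith) (by linarith)
  calc C * (1 + |x|) ^ (-β) = (1 + |x|) ^ (-p) * (C * (1 + |x|) ^ (-(β - p))) := by
        rw [hsplit]; ring
    _ ≤ _ := by gcongr

/-! ### Summability -/

/-- Since `n^(d-1) → 0`, the term `k n^d` is eventually at most `τn/2`, and a geometric series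
dominates. -/
lemma summable_exp_mul_rpow_sub {d : ℝ} (hd : d < 1) (k : ℝ) {τ : ℝ} (hτ : 0 < τ) :
    Summable fun n : ℕ => Real.exp (k * (n : ℝ) ^ d - τ * n) := by
  have hlim : Tendsto (fun n : ℕ => k * (n : ℝ) ^ (-(1 - d))) atTop (𝓝 0) := by
    simpa using ((tendsto_rpow_neg_atTop (sub_pos.2 hd)).comp
      tendsto_natCast_atTop_atTop).const_mul k
  have hgeom : Summable fun n : ℕ => Real.exp (n * (-(τ / 2))) :=
    Real.summable_exp_nat_mul_iff.2 (by linarith)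
  refine hgeom.of_norm_bounded_eventually_nat ?_
  filter_upwards [hlim.eventually_le_const (half_pos hτ), eventually_gt_atTop 0] with n hn hn0
  have hnpos : (0 : ℝ) < n := Nat.cast_pos.2 hn0
  rw [Real.norm_of_nonneg (Real.exp_pos _).le]
  refine Real.exp_le_exp.2 ?_
  have hsplit : (n : ℝ) ^ d = (n : ℝ) ^ (-(1 - d)) * n := by
    nth_rw 3 [← Real.rpow_one (n : ℝ)]
    rw [← Real.rpow_add hnpos]
    ring_nf
  rw [hsplit, ← mul_assoc]
  have := mul_le_mul_of_nonneg_right hn hnpos.le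
  linarith

lemma summable_mul_exp_neg_rpow {d p : ℝ} (hd : 0 < d) (hp : 0 < p) :
    Summable fun n : ℕ => (n : ℝ) * Real.exp (-p * (n : ℝ) ^ d) := by
  have hlim : Tendsto (fun n : ℕ => (n : ℝ) ^ d) atTop atTop :=
    (tendsto_rpow_atTop hd).comp tendsto_natCast_atTop_atTop
  -- With `y = n^d`, the power `y^(-3/d)` is `n⁻³`, which leaves `n⁻²` after multiplication by `n`.
  have hO := ((isLittleO_exp_neg_mul_rpow_atTop hp (-3 / d)).comp_tendsto hlim).bound one_pos
  refine (Real.summable_nat_rpow.2 (show (-2 : ℝ) < -1 by norm_num)).of_norm_bounded_eventually_nat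
    ?_
  filter_upwards [hO, eventually_gt_atTop 0] with n hn hn0
  have hnpos : (0 : ℝ) < n := Nat.cast_pos.2 hn0
  simp only [Function.comp_apply, one_mul] at hn
  rw [← Real.rpow_mul hnpos.le, mul_div_cancel₀ _ hd.ne',
    Real.norm_of_nonneg (Real.rpow_nonneg hnpos.le _)] at hn
  rw [norm_mul, Real.norm_of_nonneg hnpos.le]
  calc (n : ℝ) * ‖Real.exp (-p * (n : ℝ) ^ d)‖ ≤ n * (n : ℝ) ^ (-3 : ℝ) := by gcongr
    _ = (n : ℝ) ^ (-2 : ℝ) := by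
        nth_rw 1 [← Real.rpow_one (n : ℝ)]
        rw [← Real.rpow_add hnpos]
        norm_num

lemma ae_eventually_not_of_summable {Ω : Type*} [MeasurableSpace Ω] {P : Measure Ω}
    {s : ℕ → Set Ω} {b : ℕ → ℝ} (hb : Summable b) (h : ∀ n, P (s n) ≤ ENNReal.ofReal (b n)) :
    ∀ᵐ ω ∂P, ∀ᶠ n in atTop, ω ∉ s n :=
  ae_eventually_notMem (ne_top_of_le_ne_top hb.tsum_ofReal_ne_top (ENNReal.tsum_le_tsum h))

/-! ### Consistency -/

section Consistency

variable {M : ℕ} {f : Fin M → ℝ → ℝ} {θ₀ : Param M} {Ω : Type*} [MeasurableSpace Ω]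
  {P : Measure Ω} {X : ℕ → Ω → ℝ}

/-- The sample eventually stays in the bracketing window: the union bound over `n` observations is
of order `n exp(-p n^d)`, which is summable. -/
lemma ae_eventually_abs_le (hθ₀ : θ₀ ∈ paramSpace M) (h1 : TailBound f)
    (hX : ∀ i, Measurable (X i)) (hlaw : ∀ i, P.map (X i) = mixtureMeasure f θ₀)
    {d : ℝ} (hd₀ : 0 < d) :
    ∀ᵐ ω ∂P, ∀ᶠ n : ℕ in atTop, ∀ i < n, |X i ω| ≤ Real.exp ((n : ℝ) ^ d) := by
  obtain ⟨I, p, hI, hp, htail⟩ := exists_mixtureMeasure_tail_le h1 hθ₀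
  have hbound : ∀ n : ℕ, P (⋃ i ∈ Finset.range n, {ω | Real.exp ((n : ℝ) ^ d) < |X i ω|}) ≤
      ENNReal.ofReal (I * ((n : ℝ) * Real.exp (-p * (n : ℝ) ^ d))) := by
    intro n
    set A := Real.exp ((n : ℝ) ^ d) with hA
    have hset : MeasurableSet {x : ℝ | A < |x|} :=
      measurableSet_lt measurable_const continuous_abs.measurable
    calc _ ≤ ∑ i ∈ Finset.range n, P {ω | A < |X i ω|} := measure_biUnion_finset_le _ _
      _ ≤ ∑ _i ∈ Finset.range n, ENNReal.ofReal (I * A ^ (-p)) := by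
          refine Finset.sum_le_sum fun i _ => ?_
          refine le_trans (le_of_eq ?_) (htail A (Real.exp_pos _))
          rw [← hlaw i, Measure.map_apply (hX i) hset]
          rfl
      _ = _ := by
          rw [Finset.sum_const, Finset.card_range, nsmul_eq_mul, ← ENNReal.ofReal_natCast,
            ← ENNReal.ofReal_mul (Nat.cast_nonneg n), hA, ← Real.exp_mul]
          ring_nf
  filter_upwards [ae_eventually_not_of_summable
    ((summable_mul_exp_neg_rpow hd₀ hp).mul_left I) hbound] with ω hω
  filter_upwards [hω] with n hn i hi
  by_contra hlt
  exact hn (Set.mem_biUnion (Finset.mem_coe.2 (Finset.mem_range.2 hi)) (not_le.1 hlt))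

/-- The exceptional event is uniform over all far `θ` in the sieve, so the result applies to a
data-dependent `θ` with no measurability of the estimator. -/
lemma ae_eventually_likelihood_lt (hf : ∀ m, IsDensity (f m)) (hθ₀ : θ₀ ∈ paramSpace M)
    (h1 : TailBound f) (h2 : LocalSupMeasurable f) (h3 : ContinuousInParam f)
    (hX : ∀ i, Measurable (X i)) (hindep : iIndepFun X P)
    (hlaw : ∀ i, P.map (X i) = mixtureMeasure f θ₀)
    {c₀ d ε : ℝ} (hc₀ : 0 < c₀) (hd₀ : 0 < d) (hd₁ : d < 1) (hε : 0 < ε) (hε1 : ε ≤ 1) :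
    ∀ᵐ ω ∂P, ∀ᶠ n : ℕ in atTop, ∀ θ ∈ sieve M (c₀ * Real.exp (-((n : ℝ) ^ d))),
      ENNReal.ofReal ε ≤ eLpNorm (fun x => mixture f θ x - mixture f θ₀ x) 1 volume →
      likelihood f (fun i => X i ω) n θ < likelihood f (fun i => X i ω) n θ₀ := by
  have hd := IsDensity.mixture hf hθ₀
  -- Half of the affinity deficit `ε²/8`; the other half absorbs the bracketing error, leaving `1 -
  -- 2τ + τ ≤ e^{-τ}`.
  set τ : ℝ := ε ^ 2 / 16 with hτ
  have hτ0 : 0 < τ := by positivity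
  have hτ1 : τ ≤ 1 := by rw [hτ]; nlinarith
  -- Chosen so that the total excess `3Mη` has square root at most `τ`; the `+ 1` covers `M = 0`.
  set η : ℝ := τ ^ 2 / (3 * M + 1) with hη
  have hη0 : 0 < η := by positivity
  have hη1 : η ≤ 1 := by
    rw [hη, div_le_one (by positivity)]
    have : (0 : ℝ) ≤ M := M.cast_nonneg
    nlinarith
  have hMη : M * (3 * η) ≤ τ ^ 2 := by
    rw [hη, ← mul_assoc, mul_div_assoc', div_le_iff₀ (by positivity)]
    nlinarith [sq_nonneg τ]
  obtain ⟨B, hB, hbr⟩ := exists_bracket_number_le hf h1 h2 h3 hc₀ hη0 hη1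
  set F : ℝ → ℝ≥0∞ := fun x => ENNReal.ofReal (mixture f θ₀ x) with hF
  set G : ℕ → Set (ℝ → ℝ≥0∞) := fun n =>
    {g | ∃ θ ∈ sieve M (c₀ * Real.exp (-((n : ℝ) ^ d))),
      ENNReal.ofReal ε ≤ eLpNorm (fun x => mixture f θ x - mixture f θ₀ x) 1 volume ∧
      g = fun x => ENNReal.ofReal (mixture f θ x)} with hG
  have hbound : ∀ n : ℕ, P {ω | (∀ i < n, |X i ω| ≤ Real.exp ((n : ℝ) ^ d)) ∧
      ∃ g ∈ G n, ∏ i ∈ Finset.range n, F (X i ω) ≤ ∏ i ∈ Finset.range n, g (X i ω)} ≤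
      ENNReal.ofReal (B * Real.exp (4 * M * (n : ℝ) ^ d - τ * n)) := by
    intro n
    obtain ⟨N, ⟨𝒰, hcard, h𝒰⟩, hN⟩ := hbr ((n : ℝ) ^ d) (by positivity)
    have hGn : HasUpperBrackets (G n) (Real.exp ((n : ℝ) ^ d)) (ENNReal.ofReal (M * (3 * η))) N :=
      ⟨𝒰, hcard, fun g ⟨θ, hθ, _, hg⟩ => h𝒰 g ⟨θ, hθ, hg⟩⟩
    refine (measure_exists_prod_le_prod_le (a := ENNReal.ofReal (1 - ε ^ 2 / 8)) hX hindep
      hd.1.ennreal_ofReal (fun _ => ENNReal.ofReal_ne_top) hd.2.2 hlaw hGn ?_ ?_ n).trans ?_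
    · rintro _ ⟨θ, hθ, _, rfl⟩
      exact (IsDensity.mixture hf hθ.1).1.ennreal_ofReal
    · rintro _ ⟨θ, hθ, hfar, rfl⟩
      exact affinity_le_of_le_eLpNorm (IsDensity.mixture hf hθ.1) hd hε hfar
    · have hsqrt : ENNReal.ofReal (M * (3 * η)) ^ (1 / 2 : ℝ) ≤ ENNReal.ofReal τ := by
        rw [ofReal_rpow_half (by positivity)]
        exact ENNReal.ofReal_le_ofReal (Real.sqrt_le_left hτ0.le |>.2 hMη)
      have hbase : ENNReal.ofReal (1 - ε ^ 2 / 8) + ENNReal.ofReal (M * (3 * η)) ^ (1 / 2 : ℝ) ≤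
          ENNReal.ofReal (Real.exp (-τ)) := by
        refine (add_le_add_right hsqrt _).trans ?_
        rw [← ENNReal.ofReal_add (by nlinarith) hτ0.le]
        refine ENNReal.ofReal_le_ofReal (le_trans (le_of_eq ?_) (Real.add_one_le_exp (-τ)))
        rw [hτ]; ring
      calc _ ≤ (N : ℝ≥0∞) * ENNReal.ofReal (Real.exp (-τ)) ^ n := by gcongr
        _ = ENNReal.ofReal (N * Real.exp (-τ) ^ n) := by
            rw [ENNReal.ofReal_mul (Nat.cast_nonneg N), ENNReal.ofReal_natCast,
              ENNReal.ofReal_pow (Real.exp_pos _).le]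
        _ ≤ ENNReal.ofReal (B * Real.exp (4 * M * (n : ℝ) ^ d) * Real.exp (-τ) ^ n) := by gcongr
        _ = _ := by
            rw [mul_assoc, ← Real.exp_nat_mul, ← Real.exp_add]
            ring_nf
  filter_upwards [ae_eventually_abs_le hθ₀ h1 hX hlaw hd₀, ae_eventually_not_of_summable
    ((summable_exp_mul_rpow_sub hd₁ (4 * M) hτ0).mul_left B) hbound] with ω hω1 hω2
  filter_upwards [hω1, hω2] with n hn1 hn2 θ hθ hfar
  by_contra hle
  refine hn2 ⟨hn1, _, ⟨θ, hθ, hfar, rfl⟩, ?_⟩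
  have h0 := (IsDensity.mixture hf hθ.1).2.1
  rw [← ENNReal.ofReal_prod_of_nonneg fun i _ => hd.2.1 _,
    ← ENNReal.ofReal_prod_of_nonneg fun i _ => h0 _]
  exact ENNReal.ofReal_le_ofReal (not_lt.1 hle)

lemma eventually_mem_sieve (hθ₀ : θ₀ ∈ paramSpace M) (c₀ : ℝ) {d : ℝ} (hd₀ : 0 < d) :
    ∀ᶠ n : ℕ in atTop, θ₀ ∈ sieve M (c₀ * Real.exp (-((n : ℝ) ^ d))) := by
  have hlim : Tendsto (fun n : ℕ => c₀ * Real.exp (-((n : ℝ) ^ d))) atTop (𝓝 0) := by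
    simpa using (Real.tendsto_exp_neg_atTop_nhds_zero.comp
      ((tendsto_rpow_atTop hd₀).comp tendsto_natCast_atTop_atTop)).const_mul c₀
  have h := eventually_all.2 fun m => hlim.eventually_le_const (hθ₀.2.2 m)
  exact h.mono fun n hn => ⟨hθ₀, hn⟩

end Consistency

end LocScaleMixture

theorem mainTheorem3
    {M : ℕ} (f : Fin M → ℝ → ℝ) (hf : ∀ m, LocScaleMixture.IsDensity (f m))
    (θ₀ : LocScaleMixture.Param M) (hθ₀ : θ₀ ∈ LocScaleMixture.paramSpace M)
    (h1 : LocScaleMixture.TailBound f)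
    (h2 : LocScaleMixture.LocalSupMeasurable f)
    (h3 : LocScaleMixture.ContinuousInParam f)
    (h4 : LocScaleMixture.FiniteEntropy f θ₀)
    (hG : LocScaleMixture.mixture f θ₀ ∈
      LocScaleMixture.subDensitiesCard f M \ LocScaleMixture.subDensitiesCard f (M - 1))
    (c₀ d : ℝ) (hc₀ : 0 < c₀) (hd₀ : 0 < d) (hd₁ : d < 1)
    {Ω : Type*} [MeasurableSpace Ω] (P : Measure Ω) [IsProbabilityMeasure P]
    (X : ℕ → Ω → ℝ) (hX : ∀ i, Measurable (X i)) (hindep : iIndepFun X P)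
    (hlaw : ∀ i, P.map (X i) = LocScaleMixture.mixtureMeasure f θ₀)
    (θhat : ℕ → Ω → LocScaleMixture.Param M)
    (hMLE : ∀ᵐ ω ∂P, ∀ᶠ n : ℕ in atTop,
      LocScaleMixture.IsMLE f (LocScaleMixture.sieve M (c₀ * Real.exp (-((n : ℝ) ^ d))))
        (fun i => X i ω) n (θhat n ω)) :
    ∀ᵐ ω ∂P, Tendsto
      (fun n : ℕ => eLpNorm
        (fun x => LocScaleMixture.mixture f (θhat n ω) x - LocScaleMixture.mixture f θ₀ x)
        1 volume)
      atTop (𝓝 0) := by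
  -- Countably many distances `1/(k+1)` suffice, so the exceptional null sets can be united.
  have hsep := ae_all_iff.2 fun k : ℕ =>
    LocScaleMixture.ae_eventually_likelihood_lt hf hθ₀ h1 h2 h3 hX hindep hlaw hc₀ hd₀ hd₁
      (ε := 1 / ((k : ℝ) + 1)) (by positivity)
      (by rw [div_le_one (by positivity)]; linarith [(k.cast_nonneg : (0 : ℝ) ≤ k)])
  filter_upwards [hMLE, hsep] with ω hω hsepω
  rw [ENNReal.tendsto_nhds_zero]
  intro δ hδ
  obtain ⟨k, hk⟩ : ∃ k : ℕ, ENNReal.ofReal (1 / ((k : ℝ) + 1)) < δ := by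
    have hlim := (ENNReal.continuous_ofReal.tendsto _).comp
      (tendsto_one_div_add_atTop_nhds_zero_nat (𝕜 := ℝ))
    rw [ENNReal.ofReal_zero] at hlim
    exact (hlim.eventually_lt_const hδ).exists
  filter_upwards [hω, hsepω k, LocScaleMixture.eventually_mem_sieve hθ₀ c₀ hd₀]
    with n hmle hlt hmem
  by_contra hcon
  -- A maximizer far from `f₀` would have strictly smaller likelihood than its competitor `θ₀` in
  -- the sieve.
  exact (hmle.2 θ₀ hmem).not_gt (hlt _ hmle.1 (hk.le.trans (not_le.1 hcon).le))
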